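/- Let $R$ be a commutative noetherian ring, let $\Phi\subseteq\operatorname{Spec}R$ be specialization-closed (if $\mathfrak p\in\Phi$ and $\mathfrak p\subseteq\mathfrak q$ are primes, then $\mathfrak q\in\Phi$), and let $n\ge 0$ be an integer. Let $\Gamma_\Phi$ be the left exact functor on $R$-modules given by $\Gamma_\Phi(M)=\{x\in M\mid \operatorname{Supp}(Rx)\subseteq\Phi\}$, let $H^i_\Phi$ be its $i$-th right derived functor, and let $$\operatorname{cd}\Phi=\sup\{i\mid H^i_\Phi(M)\neq 0\text{ for some }R\text{-module }M\}\in\{-\infty\}\cup\mathbb N\cup\{\infty\}.$$ The small support of an $R$-module $M$ is $\operatorname{supp}M=\{\mathfrak p\in\operatorname{Spec}R\mid M\otimes^{\mathbf L}_R\kappa(\mathfrak p)\not\cong 0\}$, that is, the set of primes $\mathfrak p$ such that $\operatorname{Tor}^R_i(M,\kappa(\mathfrak p))\neq0$ for some $i$, where $\kappa(\mathfrak p)=R_{\mathfrak p}/\mathfrak pR_{\mathfrak p}$. If $\operatorname{cd}\Phi\le n$, then the full subcategory $\mathcal X$ of all $R$-modules $X$ with $\operatorname{supp}X\subseteq\Phi^\complement=\operatorname{Spec}R\setminus\Phi$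 is $n$-wide. This means that $\mathcal X$ is closed under extensions, and that for every exact sequence $0\to M\to X^0\to\cdots\to X^n\to N\to 0$ of $R$-modules with $X^0,\dots,X^n\in\mathcal X$ one has $M\in\mathcal X$ (closure under $n$-kernels) and $N\in\mathcal X$ (closure under $n$-cokernels). -/

import Mathlib

open CategoryTheory Limits

universe u

noncomputable section

/-- The small support `supp M` of an `R`-module `M`: the set of primes `p` such that the derived
tensor product `M ⊗ᴸ κ(p)` is nonzero, i.e. has some nonzero homology module
`H_i(M ⊗ᴸ κ(p)) = Tor_i(M, κ(p))`. -/
def smallSupport {R : Type u} [CommRing R] (M : ModuleCat.{u} R) : Set (PrimeSpectrum R) :=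
  {p | ∃ i : ℕ, ¬ IsZero
    (((Tor' (ModuleCat.{u} R) i).obj M).obj (ModuleCat.of R p.asIdeal.ResidueField))}

/-- The full subcategory `supp⁻¹(Φ)` of modules whose small support is contained in `Φ`. -/
def smallSupportPreimage {R : Type u} [CommRing R] (Φ : Set (PrimeSpectrum R)) :
    ObjectProperty (ModuleCat.{u} R) :=
  fun M => smallSupport M ⊆ Φ

theorem support_span_zero_subset {R : Type u} [CommRing R] {M : Type u} [AddCommGroup M]
    [Module R M] (Φ : Set (PrimeSpectrum R)) :
    Module.support R (Submodule.span R {(0 : M)}) ⊆ Φ := by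
  rw [Submodule.span_zero_singleton, Module.support_eq_empty]
  exact Set.empty_subset _

theorem mem_support_span_singleton {R : Type u} [CommRing R] {M : Type u} [AddCommGroup M]
    [Module R M] (x : M) (p : PrimeSpectrum R) :
    p ∈ Module.support R (Submodule.span R {x}) ↔ ∀ r : R, r • x = 0 → r ∈ p.asIdeal := by
  rw [Module.mem_support_iff_of_finite]
  simp only [SetLike.le_def, Submodule.mem_annihilator_span_singleton]

/-- The `Φ`-torsion submodule `Γ_Φ(M) = {x ∈ M ∣ Supp(Rx) ⊆ Φ}`. -/
def torsionSubmodule {R : Type u} [CommRing R] (Φ : Set (PrimeSpectrum R)) (M : Type u)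
    [AddCommGroup M] [Module R M] : Submodule R M where
  carrier := {x | Module.support R (Submodule.span R {x}) ⊆ Φ}
  zero_mem' := support_span_zero_subset Φ
  add_mem' := by
    intro x y hx hy p hp
    rw [mem_support_span_singleton] at hp
    by_contra hpΦ
    have h1 : ¬ ∀ r : R, r • x = 0 → r ∈ p.asIdeal := fun h =>
      hpΦ (hx ((mem_support_span_singleton x p).2 h))
    have h2 : ¬ ∀ r : R, r • y = 0 → r ∈ p.asIdeal := fun h =>
      hpΦ (hy ((mem_support_span_singleton y p).2 h))
    push Not at h1 h2
    obtain ⟨a, ha, hap⟩ := h1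
    obtain ⟨b, hb, hbp⟩ := h2
    have : (a * b) • (x + y) = 0 := by
      rw [smul_add, mul_comm, mul_smul, ha, mul_comm, mul_smul, hb, smul_zero, smul_zero, add_zero]
    exact (p.2.mem_or_mem (hp _ this)).elim hap hbp
  smul_mem' := by
    intro c x hx p hp
    refine hx ?_
    rw [mem_support_span_singleton] at hp ⊢
    intro r hr
    exact hp r (by rw [smul_comm, hr, smul_zero])

theorem torsionSubmodule_map_mem {R : Type u} [CommRing R] (Φ : Set (PrimeSpectrum R))
    {M N : Type u} [AddCommGroup M] [Module R M] [AddCommGroup N] [Module R N] (f : M →ₗ[R] N)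
    (x : M) (hx : x ∈ torsionSubmodule Φ M) : f x ∈ torsionSubmodule Φ N := by
  intro p hp
  refine hx ?_
  rw [mem_support_span_singleton] at hp ⊢
  intro r hr
  exact hp r (by rw [← map_smul, hr, map_zero])

/-- The `Φ`-torsion functor `Γ_Φ : Mod R ⥤ Mod R`. -/
def torsionFunctor {R : Type u} [CommRing R] (Φ : Set (PrimeSpectrum R)) :
    ModuleCat.{u} R ⥤ ModuleCat.{u} R where
  obj M := ModuleCat.of R (torsionSubmodule Φ M)
  map f := ModuleCat.ofHom (f.hom.restrict (torsionSubmodule_map_mem Φ f.hom))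
  map_id _ := rfl
  map_comp _ _ := rfl

instance torsionFunctor_additive {R : Type u} [CommRing R] (Φ : Set (PrimeSpectrum R)) :
    (torsionFunctor Φ).Additive where
  map_add := rfl

/-- The `i`-th local cohomology functor `H^i_Φ`, the `i`-th right derived functor of `Γ_Φ`. -/
def localCohomologyFunctor {R : Type u} [CommRing R] (Φ : Set (PrimeSpectrum R)) (i : ℕ) :
    ModuleCat.{u} R ⥤ ModuleCat.{u} R :=
  (torsionFunctor Φ).rightDerived i

/-- The cohomological dimension `cd Φ = sup {i ∣ H^i_Φ(M) ≠ 0 for some M}`, with value `⊥`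
(that is, `-∞`) when there is no such `i`, and `⊤` when the set is unbounded. -/
def cohomologicalDimension {R : Type u} [CommRing R] (Φ : Set (PrimeSpectrum R)) :
    WithBot ℕ∞ :=
  sSup {d | ∃ i : ℕ, d = ((i : ℕ∞) : WithBot ℕ∞) ∧
    ∃ M : ModuleCat.{u} R, ¬ IsZero ((localCohomologyFunctor Φ i).obj M)}

/-- The exact sequences `0 ⟶ M ⟶ X⁰ ⟶ ⋯ ⟶ Xⁿ ⟶ N ⟶ 0`. Here `S` has the `n + 3` objects
`M, X⁰, …, Xⁿ, N` at the positions `0, 1, …, n + 1, n + 2`. -/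
structure IsExactWithZeroEnds {R : Type u} [CommRing R] {n : ℕ}
    (S : ComposableArrows (ModuleCat.{u} R) (n + 2)) : Prop where
  exact : S.Exact
  mono : Mono (S.map' 0 1)
  epi : Epi (S.map' (n + 1) (n + 2))

/-- Closure under `n`-kernels: in an exact sequence `0 ⟶ M ⟶ X⁰ ⟶ ⋯ ⟶ Xⁿ ⟶ N ⟶ 0` with all
`Xⁱ` in `P`, the module `M` is in `P`. -/
def IsClosedUnderNKernels {R : Type u} [CommRing R] (P : ObjectProperty (ModuleCat.{u} R))
    (n : ℕ) : Prop :=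
  ∀ S : ComposableArrows (ModuleCat.{u} R) (n + 2), IsExactWithZeroEnds S →
    (∀ (i : ℕ) (hi : i ≤ n), P (S.obj' (i + 1))) → P (S.obj' 0)

/-- Closure under `n`-cokernels: in an exact sequence `0 ⟶ M ⟶ X⁰ ⟶ ⋯ ⟶ Xⁿ ⟶ N ⟶ 0` with all
`Xⁱ` in `P`, the module `N` is in `P`. -/
def IsClosedUnderNCokernels {R : Type u} [CommRing R] (P : ObjectProperty (ModuleCat.{u} R))
    (n : ℕ) : Prop :=
  ∀ S : ComposableArrows (ModuleCat.{u} R) (n + 2), IsExactWithZeroEnds S →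
    (∀ (i : ℕ) (hi : i ≤ n), P (S.obj' (i + 1))) → P (S.obj' (n + 2))

/-- A (full) subcategory of `Mod R` is `n`-wide if it is closed under extensions, `n`-kernels and
`n`-cokernels. -/
structure IsNWide {R : Type u} [CommRing R] (P : ObjectProperty (ModuleCat.{u} R))
    (n : ℕ) : Prop where
  extensions : P.IsClosedUnderExtensions
  nKernels : IsClosedUnderNKernels P n
  nCokernels : IsClosedUnderNCokernels P n

end

/-! Write H^i(M) for the colimit of Ext^i(R/I, M) over the ideals I with V(I) ⊆ Φ (`ExtColim`). It
stands in for local cohomology: in positive degrees the vanishing of H^i_Φ(M) forces that of H^i(M),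
so cd Φ ≤ n gives H^i = 0 for i > n. The crux is `smallSupportPreimage_compl_iff`: supp M avoids Φ
if and only if H^i(M) = 0 for all i. Extensions are then handled by the long exact sequence. For 0 →
M → X^0 → ⋯ → X^n → N → 0, cut into short exact sequences, the vanishing of H^i(N) follows from
H^{i+n+1}(M) = 0. For i ≤ n that of H^i(M) follows from H^0 = 0 for a submodule of X^i.

Criterion, forward. If Tor(M, κ(p)) = 0 for all p in Φ, noetherian induction gives Tor(M, W) = 0 for
every Φ-torsion W (`SyzygyTower.torVanishes_of_isPhiTorsion`), in particular for W = H^i(R). As H^i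
is compatible with direct sums and vanishes above n, descending induction on i identifies H^i(M)
with M ⊗ H^i(R) = 0 (`ExtColim.tensorMap_syzygy_bijective`).

Criterion, backward. Let all H^i(M) vanish and let N, with syzygies Z'_t, be killed by p in Φ. Then
Tor_{t+1}(M, N) is the kernel of M ⊗ Z'_{t+1} → M ⊗ P'_t; it is killed by p, hence has no higher H.
Descending induction yields H^i(M ⊗ Z'_t) = 0 for all i and t. So M ⊗ Z'_t has no Φ-torsion, and its
torsion submodule Tor_t(M, N), t > 0, is zero; in degree 0 the torsion module M ⊗ N itself is zero
(`ExtColim.torVanishes_of_subsingleton`). -/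

open TensorProduct Abelian

/-! ### Diagram chases on kernels of tensored inclusions -/

section Chases

variable {R : Type*} [CommRing R]
variable {A B C A' B' C' : Type*} [AddCommGroup A] [AddCommGroup B] [AddCommGroup C]
  [AddCommGroup A'] [AddCommGroup B'] [AddCommGroup C'] [Module R A] [Module R B] [Module R C]
  [Module R A'] [Module R B'] [Module R C']

theorem rTensor_lTensor_apply_comm (f : A →ₗ[R] B) (g : A' →ₗ[R] B') (x : A ⊗[R] A') :
    f.rTensor B' (g.lTensor A x) = g.lTensor B (f.rTensor A' x) := by
  rw [← LinearMap.comp_apply, ← LinearMap.comp_apply, LinearMap.rTensor_comp_lTensor,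
    LinearMap.lTensor_comp_rTensor]

theorem comm_rTensor_apply (f : A →ₗ[R] B) (x : A ⊗[R] C) :
    TensorProduct.comm R B C (f.rTensor C x) = f.lTensor C (TensorProduct.comm R A C x) := by
  induction x with
  | zero => simp
  | tmul a c => simp
  | add x y hx hy => simp only [map_add, hx, hy]

/-- For exact `A → B → C → 0` and `0 → A' → B' → C' → 0` with `B` flat, an element killing the
kernel of `A ⊗ C' → B ⊗ C'` kills the kernel of `C ⊗ A' → C ⊗ B'`. -/
theorem smul_ker_lTensor_of_smul_ker_rTensor [Module.Flat R B]
    {f : A →ₗ[R] B} {g : B →ₗ[R] C} (hfg : Function.Exact f g) (hg : Function.Surjective g)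
    {f' : A' →ₗ[R] B'} {g' : B' →ₗ[R] C'} (hf' : Function.Injective f')
    (hfg' : Function.Exact f' g') (hg' : Function.Surjective g') (r : R)
    (h : ∀ x : A ⊗[R] C', f.rTensor C' x = 0 → r • x = 0)
    (x : C ⊗[R] A') (hx : f'.lTensor C x = 0) : r • x = 0 := by
  -- The snake lemma: w represents a preimage of x under the connecting map ker(A ⊗ C' → B ⊗ C') → C
  -- ⊗ A', whose image is the kernel in question.
  obtain ⟨b, rfl⟩ := LinearMap.rTensor_surjective A' hg x
  rw [← rTensor_lTensor_apply_comm] at hx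
  obtain ⟨w, hw⟩ := (rTensor_exact B' hfg hg _).1 hx
  have h1 : f.rTensor C' (g'.lTensor A w) = 0 := by
    rw [rTensor_lTensor_apply_comm, hw]
    exact (lTensor_exact B hfg' hg').apply_apply_eq_zero b
  have h2 := h _ h1
  rw [← map_smul] at h2
  obtain ⟨v, hv⟩ := (lTensor_exact A hfg' hg' _).1 h2
  have h3 : f.rTensor A' v = r • b := by
    apply Module.Flat.lTensor_preserves_injective_linearMap (M := B) f' hf'
    rw [← rTensor_lTensor_apply_comm, hv, map_smul, map_smul, hw]
  rw [← map_smul, ← h3]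
  exact (rTensor_exact A' hfg hg).apply_apply_eq_zero v

theorem smul_ker_rTensor_of_smul_ker_lTensor [Module.Flat R B']
    {f : A →ₗ[R] B} {g : B →ₗ[R] C} (hf : Function.Injective f) (hfg : Function.Exact f g)
    (hg : Function.Surjective g)
    {f' : A' →ₗ[R] B'} {g' : B' →ₗ[R] C'}
    (hfg' : Function.Exact f' g') (hg' : Function.Surjective g') (r : R)
    (h : ∀ x : C ⊗[R] A', f'.lTensor C x = 0 → r • x = 0)
    (x : A ⊗[R] C') (hx : f.rTensor C' x = 0) : r • x = 0 := by
  have := smul_ker_lTensor_of_smul_ker_rTensor (f := f') (g := g') (f' := f) (g' := g)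
    hfg' hg' hf hfg hg r (fun y hy => by
      apply (TensorProduct.comm R A' C).injective
      rw [map_smul, map_zero]
      apply h
      rw [← comm_rTensor_apply, hy, map_zero]) (TensorProduct.comm R A C' x) (by
      rw [← comm_rTensor_apply, hx, map_zero])
  rw [← map_smul] at this
  exact (TensorProduct.comm R A C').map_eq_zero_iff.1 this

/-- The kernels of `A ⊗ A' → A ⊗ B'` and of `A ⊗ A' → B ⊗ A'` agree if `B` and `B'` are flat and
`A ⊆ B`, `A' ⊆ B'`. -/
theorem lTensor_eq_zero_iff_rTensor_eq_zero [Module.Flat R B] [Module.Flat R B']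
    {f : A →ₗ[R] B} (hf : Function.Injective f) {f' : A' →ₗ[R] B'} (hf' : Function.Injective f')
    (x : A ⊗[R] A') : f'.lTensor A x = 0 ↔ f.rTensor A' x = 0 := by
  have h1 := Module.Flat.rTensor_preserves_injective_linearMap (M := B') f hf
  have h2 := Module.Flat.lTensor_preserves_injective_linearMap (M := B) f' hf'
  rw [← (injective_iff_map_eq_zero' _).1 h1, rTensor_lTensor_apply_comm,
    (injective_iff_map_eq_zero' _).1 h2]

end Chases

/-! ### Tor through syzygies: balance and long exact sequences -/

/-- Short exact sequences `0 → Z (s + 1) → P s → Z s → 0` with `P s` projective, the syzygies of a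
projective resolution of `Z 0`. -/
structure SyzygyTower (R : Type u) [CommRing R] where
  P : ℕ → ModuleCat.{u} R
  Z : ℕ → ModuleCat.{u} R
  incl (s : ℕ) : Z (s + 1) →ₗ[R] P s
  proj (s : ℕ) : P s →ₗ[R] Z s
  incl_injective (s : ℕ) : Function.Injective (incl s)
  exact (s : ℕ) : Function.Exact (incl s) (proj s)
  proj_surjective (s : ℕ) : Function.Surjective (proj s)
  projective (s : ℕ) : Module.Projective R (P s)

namespace SyzygyTower

variable {R : Type u} [CommRing R] (D D' : SyzygyTower R)

instance (s : ℕ) : Module.Projective R (D.P s) := D.projective s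

/-- The vanishing of `Tor_k(Z 0, W)`, in terms of syzygies. -/
def TorVanishes (W : Type u) [AddCommGroup W] [Module R W] : ℕ → Prop
  | 0 => Subsingleton (D.Z 0 ⊗[R] W)
  | s + 1 => Function.Injective ((D.incl s).rTensor W)

/-- Both kernels are Tor_{t+s+1}(Z 0, Z' 0), computed from one resolution or the other. The
annihilator form serves twice: r in p shows that Tor is killed by p, and r = 1 transports vanishing.
-/
theorem balance (r : R) (t : ℕ) : ∀ s : ℕ,
    (∀ x : D.Z (t + s + 1) ⊗[R] D'.Z 0, (D.incl (t + s)).rTensor _ x = 0 → r • x = 0) ↔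
    (∀ x : D.Z s ⊗[R] D'.Z (t + 1), (D'.incl t).lTensor _ x = 0 → r • x = 0) := by
  have key (s t : ℕ) :
      (∀ x : D.Z (s + 1) ⊗[R] D'.Z t, (D.incl s).rTensor _ x = 0 → r • x = 0) ↔
      (∀ x : D.Z s ⊗[R] D'.Z (t + 1), (D'.incl t).lTensor _ x = 0 → r • x = 0) :=
    ⟨smul_ker_lTensor_of_smul_ker_rTensor (D.exact s) (D.proj_surjective s) (D'.incl_injective t)
      (D'.exact t) (D'.proj_surjective t) r,
    smul_ker_rTensor_of_smul_ker_lTensor (D.incl_injective s) (D.exact s) (D.proj_surjective s)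
      (D'.exact t) (D'.proj_surjective t) r⟩
  induction t with
  | zero =>
    intro s
    rw [zero_add]
    exact key s 0
  | succ t ih =>
    intro s
    -- Both sides now concern kernels inside Z (s + 1) ⊗ Z' (t + 1), one for each factor's
    -- inclusion; these coincide because the ambient projectives are flat.
    rw [← key, show t + 1 + s = t + (s + 1) by omega, ih (s + 1)]
    simp only [lTensor_eq_zero_iff_rTensor_eq_zero (D.incl_injective s) (D'.incl_injective t)]

variable {W₁ W₂ W₃ : Type u} [AddCommGroup W₁] [AddCommGroup W₂] [AddCommGroup W₃] [Module R W₁]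
  [Module R W₂] [Module R W₃]

variable {D} in
theorem TorVanishes.of_linearEquiv {k : ℕ} (h : D.TorVanishes W₁ k) (e : W₁ ≃ₗ[R] W₂) :
    D.TorVanishes W₂ k := by
  cases k with
  | zero =>
    have : Subsingleton (D.Z 0 ⊗[R] W₁) := h
    exact (e.lTensor (D.Z 0)).symm.toEquiv.subsingleton
  | succ s =>
    refine (injective_iff_map_eq_zero _).2 fun x hx => ?_
    have h' : Function.Injective ((D.incl s).rTensor W₁) := h
    have : e.symm.toLinearMap.lTensor _ x = 0 := by
      apply h'
      rw [rTensor_lTensor_apply_comm, hx, map_zero, map_zero]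
    exact (e.symm.lTensor _).map_eq_zero_iff.1 this

variable {D}
variable {f : W₁ →ₗ[R] W₂} {g : W₂ →ₗ[R] W₃}

theorem TorVanishes.mid {k : ℕ} (hf : Function.Injective f) (hfg : Function.Exact f g)
    (hg : Function.Surjective g) (h₁ : D.TorVanishes W₁ k) (h₃ : D.TorVanishes W₃ k) :
    D.TorVanishes W₂ k := by
  cases k with
  | zero =>
    have h₁ : Subsingleton (D.Z 0 ⊗[R] W₁) := h₁
    have h₃ : Subsingleton (D.Z 0 ⊗[R] W₃) := h₃
    refine subsingleton_of_forall_eq 0 fun x => ?_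
    obtain ⟨y, rfl⟩ := (lTensor_exact (D.Z 0) hfg hg x).1 (Subsingleton.elim _ _)
    rw [Subsingleton.elim y 0, map_zero]
  | succ s =>
    refine (injective_iff_map_eq_zero _).2 fun x hx => ?_
    have h₁ : Function.Injective ((D.incl s).rTensor W₁) := h₁
    have h₃ : Function.Injective ((D.incl s).rTensor W₃) := h₃
    obtain ⟨y, rfl⟩ := (lTensor_exact _ hfg hg x).1 (by
      apply h₃
      rw [rTensor_lTensor_apply_comm, hx, map_zero, map_zero])
    have : y = 0 := by
      apply h₁
      apply Module.Flat.lTensor_preserves_injective_linearMap (M := D.P s) f hf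
      rw [← rTensor_lTensor_apply_comm, hx, map_zero, map_zero]
    rw [this, map_zero]

/-- The kernel is a quotient of Tor_1(Z s, W₃) = Tor_{s+1}(Z 0, W₃). -/
theorem TorVanishes.lTensor_injective {s : ℕ} (hf : Function.Injective f)
    (hfg : Function.Exact f g) (hg : Function.Surjective g) (h₃ : D.TorVanishes W₃ (s + 1)) :
    Function.Injective (f.lTensor (D.Z s)) := by
  refine (injective_iff_map_eq_zero _).2 fun x hx => ?_
  have := smul_ker_lTensor_of_smul_ker_rTensor (D.exact s) (D.proj_surjective s) hf hfg hg 1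
    (fun y hy => by rw [one_smul]; exact h₃ (by rw [hy, map_zero])) x hx
  rwa [one_smul] at this

theorem TorVanishes.left {k : ℕ} (hf : Function.Injective f) (hfg : Function.Exact f g)
    (hg : Function.Surjective g) (h₂ : D.TorVanishes W₂ k) (h₃ : D.TorVanishes W₃ (k + 1)) :
    D.TorVanishes W₁ k := by
  have h := h₃.lTensor_injective hf hfg hg
  cases k with
  | zero =>
    have : Subsingleton (D.Z 0 ⊗[R] W₂) := h₂
    exact h.subsingleton
  | succ s =>
    have h₂ : Function.Injective ((D.incl s).rTensor W₂) := h₂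
    have := h₂.comp h
    refine (injective_iff_map_eq_zero _).2 fun x hx => ?_
    apply this
    simp only [Function.comp_apply, rTensor_lTensor_apply_comm, hx, map_zero]

theorem TorVanishes.right_zero (hg : Function.Surjective g) (h₂ : D.TorVanishes W₂ 0) :
    D.TorVanishes W₃ 0 := by
  have : Subsingleton (D.Z 0 ⊗[R] W₂) := h₂
  exact (LinearMap.lTensor_surjective (D.Z 0) hg).subsingleton

/-- The stretch Tor_{k+1}(W₂) → Tor_{k+1}(W₃) → Tor_k(W₁) of the long exact sequence. -/
theorem TorVanishes.right {k : ℕ} (hf : Function.Injective f) (hfg : Function.Exact f g)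
    (hg : Function.Surjective g) (h₂ : D.TorVanishes W₂ (k + 1)) (h₁ : D.TorVanishes W₁ k) :
    D.TorVanishes W₃ (k + 1) := by
  have h : Function.Injective (f.lTensor (D.Z k)) := by
    cases k with
    | zero =>
      have : Subsingleton (D.Z 0 ⊗[R] W₁) := h₁
      exact Function.injective_of_subsingleton _
    | succ s =>
      have h₁ : Function.Injective ((D.incl s).rTensor W₁) := h₁
      have := (Module.Flat.lTensor_preserves_injective_linearMap (M := D.P s) f hf).comp h₁
      refine (injective_iff_map_eq_zero _).2 fun x hx => ?_
      apply this
      simp only [Function.comp_apply, ← rTensor_lTensor_apply_comm, hx, map_zero]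
  refine (injective_iff_map_eq_zero _).2 fun x hx => ?_
  obtain ⟨x, rfl⟩ := LinearMap.lTensor_surjective _ hg x
  rw [rTensor_lTensor_apply_comm] at hx
  obtain ⟨y, hy⟩ := (lTensor_exact _ hfg hg _).1 hx
  have h1 : (D.proj k).rTensor W₁ y = 0 := by
    apply h
    rw [map_zero, ← rTensor_lTensor_apply_comm, hy]
    exact (rTensor_exact W₂ (D.exact k) (D.proj_surjective k)).apply_apply_eq_zero x
  obtain ⟨z, rfl⟩ := (rTensor_exact W₁ (D.exact k) (D.proj_surjective k) _).1 h1
  have h2 : f.lTensor _ z = x := by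
    apply h₂
    rw [rTensor_lTensor_apply_comm, hy]
  rw [← h2]
  exact (lTensor_exact _ hfg hg).apply_apply_eq_zero z

end SyzygyTower

/-! ### From residue fields to all Φ-torsion modules -/

theorem DirectSum.tensorProduct_ext {R : Type*} [CommRing R] {ι : Type*} {Z : Type*}
    [AddCommGroup Z] [Module R Z] {M : ι → Type*} [∀ i, AddCommGroup (M i)] [∀ i, Module R (M i)]
    (x : Z ⊗[R] (DirectSum ι M))
    (hx : ∀ i, (DirectSum.component R ι M i).lTensor Z x = 0) : x = 0 := by
  classical
  have key : ∀ y : Z ⊗[R] (DirectSum ι M), ∀ i, TensorProduct.directSumRight R R Z M y i =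
      (DirectSum.component R ι M i).lTensor Z y := by
    intro y i
    induction y with
    | zero => simp
    | tmul z m =>
      induction m using DirectSum.induction_on with
      | zero => simp
      | of j m =>
        rw [← DirectSum.lof_eq_of R, TensorProduct.directSumRight_tmul_lof, LinearMap.lTensor_tmul]
        by_cases h : i = j
        · subst h
          simp
        · rw [DirectSum.lof_eq_of, DirectSum.of_eq_of_ne _ _ _ h]
          change 0 = z ⊗ₜ[R] (DirectSum.of M j m i)
          rw [DirectSum.of_eq_of_ne _ _ _ h, tmul_zero]
      | add a b ha hb => simp only [tmul_add, map_add, DirectSum.add_apply, ha, hb]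
    | add a b ha hb => simp only [map_add, DirectSum.add_apply, ha, hb]
  apply (TensorProduct.directSumRight R R Z M).injective
  ext i
  rw [key, hx, map_zero, DirectSum.zero_apply]

/-- `M` is `Φ`-torsion if every element is annihilated by an ideal `I` with `V(I) ⊆ Φ`. -/
def IsPhiTorsion {R : Type u} [CommRing R] (Φ : Set (PrimeSpectrum R)) (M : Type*)
    [AddCommGroup M] [Module R M] : Prop :=
  ∀ x : M, PrimeSpectrum.zeroLocus (Ideal.torsionOf R M x : Set R) ⊆ Φ

namespace SyzygyTower

variable {R : Type u} [CommRing R] {D : SyzygyTower R}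

theorem TorVanishes.directSum {ι : Type u} {M : ι → Type u} [∀ i, AddCommGroup (M i)]
    [∀ i, Module R (M i)] {k : ℕ} (h : ∀ i, D.TorVanishes (M i) k) :
    D.TorVanishes (DirectSum ι M) k := by
  cases k with
  | zero =>
    refine subsingleton_of_forall_eq 0 fun x => DirectSum.tensorProduct_ext x fun i => ?_
    have : Subsingleton (D.Z 0 ⊗[R] M i) := h i
    exact Subsingleton.elim _ _
  | succ s =>
    refine (injective_iff_map_eq_zero _).2 fun x hx => DirectSum.tensorProduct_ext x fun i => ?_
    have h : Function.Injective ((D.incl s).rTensor (M i)) := h i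
    apply h
    rw [rTensor_lTensor_apply_comm, hx, map_zero, map_zero]

theorem TorVanishes.of_subsingleton {W : Type u} [AddCommGroup W] [Module R W] [Subsingleton W]
    (k : ℕ) : D.TorVanishes W k := by
  have h (s) : Subsingleton (D.Z s ⊗[R] W) := by
    refine subsingleton_of_forall_eq 0 fun x => ?_
    induction x with
    | zero => rfl
    | tmul z w => rw [Subsingleton.elim w 0, tmul_zero]
    | add x y hx hy => rw [hx, hy, add_zero]
  cases k with
  | zero => exact h 0
  | succ s => exact Function.injective_of_subsingleton _

/-- If `Tor(R ⧸ J) = 0` for all `J` in a filter `F` of ideals, then `Tor(W) = 0` for all modules `W`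
with annihilators of elements in `F`. -/
theorem TorVanishes.of_torsionOf_mem {F : Ideal R → Prop} (htop : F ⊤)
    (hinf : ∀ I, F I → ∀ J, F J → F (I ⊓ J)) (hup : ∀ I, F I → ∀ J, I ≤ J → F J)
    (hF : ∀ I, F I → ∀ k, D.TorVanishes (R ⧸ I) k) (k : ℕ) :
    ∀ (W : Type u) [AddCommGroup W] [Module R W], (∀ x : W, F (Ideal.torsionOf R W x)) →
      D.TorVanishes W k := by
  classical
  induction k with
  | zero =>
    intro W _ _ hW
    have h := TorVanishes.directSum (D := D) (k := 0) fun x : W => hF _ (hW x) 0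
    refine TorVanishes.right_zero (g := DirectSum.toModule R W W
      fun x => (Ideal.torsionOf R W x).liftQ (LinearMap.toSpanSingleton R W x) le_rfl) ?_ h
    exact fun x => ⟨DirectSum.lof R W _ x (Submodule.Quotient.mk 1),
      (DirectSum.toModule_lof R x _).trans (one_smul R x)⟩
  | succ k ih =>
    intro W _ _ hW
    have h := TorVanishes.directSum (D := D) (k := k + 1) fun x : W => hF _ (hW x) (k + 1)
    set g := DirectSum.toModule R W W
      fun x => (Ideal.torsionOf R W x).liftQ (LinearMap.toSpanSingleton R W x) le_rfl
    -- W is a quotient of the direct sum of the R/ann(x), x in W. The kernel again has annihilators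
    -- in F, since elements of the sum have finite support and F is closed under intersections, so
    -- degree k applies to it.
    refine TorVanishes.right (W₁ := LinearMap.ker g) (f := (LinearMap.ker g).subtype) (g := g)
      Subtype.val_injective (LinearMap.exact_subtype_ker_map g)
      (fun x => ⟨DirectSum.lof R W _ x (Submodule.Quotient.mk 1),
        (DirectSum.toModule_lof R x _).trans (one_smul R x)⟩) h (ih _ ?_)
    rintro ⟨x, hx⟩
    have key : ∀ x : DirectSum W fun x => R ⧸ Ideal.torsionOf R W x,
        F (Ideal.torsionOf R _ x) := by
      intro x
      induction x using DirectSum.induction_on with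
      | zero => rwa [Ideal.torsionOf_zero]
      | of w y =>
        refine hup _ (hW w) _ fun r hr => ?_
        rw [Ideal.mem_torsionOf_iff, ← DirectSum.lof_eq_of R, ← map_smul]
        obtain ⟨y, rfl⟩ := Submodule.Quotient.mk_surjective _ y
        rw [← Submodule.Quotient.mk_smul, (Submodule.Quotient.mk_eq_zero _).2, map_zero]
        exact Ideal.mul_mem_right _ _ hr
      | add a b ha hb =>
        refine hup _ (hinf _ ha _ hb) _ fun r hr => ?_
        rw [Ideal.mem_torsionOf_iff, smul_add, (Ideal.mem_torsionOf_iff _ _).1 hr.1,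
          (Ideal.mem_torsionOf_iff _ _).1 hr.2, add_zero]
    refine hup _ (key x) _ fun r hr => ?_
    rw [Ideal.mem_torsionOf_iff] at hr ⊢
    exact Subtype.ext hr

theorem TorVanishes.of_cyclic {W : Type u} [AddCommGroup W] [Module R W] {w : W}
    (hw : Submodule.span R {w} = ⊤) {k : ℕ} (h : D.TorVanishes (R ⧸ Ideal.torsionOf R W w) k) :
    D.TorVanishes W k := by
  refine h.of_linearEquiv ((LinearMap.toSpanSingleton R W w).quotKerEquivOfSurjective ?_)
  rw [← LinearMap.range_eq_top, LinearMap.range_toSpanSingleton, hw]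

variable (D)

/-- R/p embeds in κ(p), and each element a/s of the cokernel is killed by p and by s ∉ p. The
annihilators there are strictly larger than p, and the ideals strictly containing a prime form a
filter. -/
theorem torVanishes_quotient_prime {p : Ideal R} [p.IsPrime]
    (hp : ∀ k, D.TorVanishes p.ResidueField k) (h : ∀ J, p < J → ∀ k, D.TorVanishes (R ⧸ J) k)
    (k : ℕ) : D.TorVanishes (R ⧸ p) k := by
  let f : (R ⧸ p) →ₗ[R] p.ResidueField := (IsScalarTower.toAlgHom R (R ⧸ p) _).toLinearMap
  have hf : Function.Injective f := IsFractionRing.injective (R ⧸ p) p.ResidueField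
  refine TorVanishes.left (f := f) (g := (LinearMap.range f).mkQ) hf
    (LinearMap.exact_map_mkQ_range f) (Submodule.mkQ_surjective _) (hp k) ?_
  refine TorVanishes.of_torsionOf_mem (F := fun J => p < J) ?_ ?_ ?_ h (k + 1) _ ?_
  · exact lt_top_iff_ne_top.2 (Ideal.IsPrime.ne_top ‹_›)
  · intro I hI J hJ
    obtain ⟨a, ha, hap⟩ := Set.exists_of_ssubset hI
    obtain ⟨b, hb, hbp⟩ := Set.exists_of_ssubset hJ
    refine lt_of_le_not_ge (le_inf hI.le hJ.le) fun hle => ?_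
    exact (Ideal.IsPrime.mem_or_mem ‹p.IsPrime›
      (hle ⟨I.mul_mem_right b ha, J.mul_mem_left a hb⟩)).elim hap hbp
  · exact fun I hI J hIJ => lt_of_lt_of_le hI hIJ
  · intro x
    obtain ⟨y, rfl⟩ := Submodule.mkQ_surjective _ x
    obtain ⟨a, b, hb, rfl⟩ := IsFractionRing.div_surjective (A := R ⧸ p) y
    obtain ⟨s, rfl⟩ := Ideal.Quotient.mk_surjective b
    have hs : s ∉ p := fun hs => nonZeroDivisors.ne_zero hb (Ideal.Quotient.eq_zero_iff_mem.2 hs)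
    change p < _
    refine lt_of_le_not_ge (fun r hr => ?_) fun hle => hs (hle ?_)
    · rw [Ideal.mem_torsionOf_iff, ← map_smul]
      have : r • (algebraMap (R ⧸ p) p.ResidueField a /
          algebraMap (R ⧸ p) p.ResidueField (Ideal.Quotient.mk p s)) = 0 := by
        rw [Algebra.smul_def, Ideal.algebraMap_residueField_eq_zero.2 hr, zero_mul]
      rw [this, map_zero]
    · rw [Ideal.mem_torsionOf_iff, ← map_smul, Submodule.mkQ_apply, Submodule.Quotient.mk_eq_zero]
      refine ⟨a, ?_⟩
      have hs' : algebraMap (R ⧸ p) p.ResidueField (Ideal.Quotient.mk p s) ≠ 0 := by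
        exact fun h0 => nonZeroDivisors.ne_zero hb (hf (h0.trans (map_zero f).symm))
      rw [Algebra.smul_def, IsScalarTower.algebraMap_apply R (R ⧸ p) p.ResidueField,
        Ideal.Quotient.algebraMap_eq, mul_div_cancel₀ _ hs']
      rfl

variable [IsNoetherianRing R]

/-- Noetherian induction on I. If I is proper and not prime, choose ab ∈ I with a, b ∉ I: the
submodule generated by a in R/I and its quotient are cyclic, with annihilators strictly above I
because they contain b and a respectively. -/
theorem torVanishes_quotient {Φ : Set (PrimeSpectrum R)}
    (h : ∀ p ∈ Φ, ∀ k, D.TorVanishes p.asIdeal.ResidueField k) (I : Ideal R)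
    (hI : PrimeSpectrum.zeroLocus (I : Set R) ⊆ Φ) (k : ℕ) : D.TorVanishes (R ⧸ I) k := by
  induction I using WellFoundedGT.induction generalizing k with
  | _ I ih =>
  have ih' : ∀ J, I < J → ∀ k, D.TorVanishes (R ⧸ J) k := fun J hJ k =>
    ih J hJ ((PrimeSpectrum.zeroLocus_anti_mono hJ.le).trans hI) k
  by_cases hp : I.IsPrime
  · exact D.torVanishes_quotient_prime (h ⟨I, hp⟩ (hI (by simp))) ih' k
  by_cases htop : I = ⊤
  · subst htop
    have : Subsingleton (R ⧸ (⊤ : Ideal R)) := Ideal.Quotient.subsingleton_iff.2 rfl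
    exact TorVanishes.of_subsingleton k
  obtain ⟨a, ha, b, hb, hab⟩ : ∃ a ∉ I, ∃ b ∉ I, a * b ∈ I := by
    rw [Ideal.isPrime_iff] at hp
    push Not at hp
    obtain ⟨a, b, hab, ha, hb⟩ := hp htop
    exact ⟨a, ha, b, hb, hab⟩
  let x : R ⧸ I := Submodule.Quotient.mk a
  refine TorVanishes.mid (f := (Submodule.span R {x}).subtype) (g := (Submodule.span R {x}).mkQ)
    Subtype.val_injective (LinearMap.exact_subtype_mkQ _) (Submodule.mkQ_surjective _) ?_ ?_
  · refine TorVanishes.of_cyclic (w := ⟨x, Submodule.mem_span_singleton_self x⟩) ?_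
      (ih' _ (lt_of_le_not_ge (fun r hr => ?_) fun hle => hb (hle ?_)) k)
    · rw [eq_top_iff]
      rintro ⟨y, hy⟩ -
      obtain ⟨r, rfl⟩ := Submodule.mem_span_singleton.1 hy
      exact Submodule.mem_span_singleton.2 ⟨r, rfl⟩
    · rw [Ideal.mem_torsionOf_iff]
      refine Subtype.ext ((Submodule.Quotient.mk_eq_zero I).2 (?_ : r • a ∈ I))
      exact I.mul_mem_right a hr
    · rw [Ideal.mem_torsionOf_iff]
      refine Subtype.ext ((Submodule.Quotient.mk_eq_zero I).2 (?_ : b • a ∈ I))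
      rwa [smul_eq_mul, mul_comm]
  · refine TorVanishes.of_cyclic (w := (Submodule.span R {x}).mkQ (Submodule.Quotient.mk 1)) ?_
      (ih' _ (lt_of_le_not_ge (fun r hr => ?_) fun hle => ha (hle ?_)) k)
    · rw [eq_top_iff]
      rintro y -
      obtain ⟨y, rfl⟩ := Submodule.mkQ_surjective _ y
      obtain ⟨r, rfl⟩ := Submodule.Quotient.mk_surjective _ y
      refine Submodule.mem_span_singleton.2 ⟨r, ?_⟩
      rw [← map_smul, ← Submodule.Quotient.mk_smul, smul_eq_mul, mul_one]
    · rw [Ideal.mem_torsionOf_iff, ← map_smul, ← Submodule.Quotient.mk_smul, smul_eq_mul, mul_one,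
        (Submodule.Quotient.mk_eq_zero I).2 hr, map_zero]
    · rw [Ideal.mem_torsionOf_iff, ← map_smul, ← Submodule.Quotient.mk_smul, smul_eq_mul, mul_one,
        Submodule.mkQ_apply, Submodule.Quotient.mk_eq_zero]
      exact Submodule.mem_span_singleton_self x

theorem torVanishes_of_isPhiTorsion {Φ : Set (PrimeSpectrum R)}
    (h : ∀ p ∈ Φ, ∀ k, D.TorVanishes p.asIdeal.ResidueField k) {W : Type u} [AddCommGroup W]
    [Module R W] (hW : IsPhiTorsion Φ W) (k : ℕ) : D.TorVanishes W k := by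
  refine TorVanishes.of_torsionOf_mem
    (F := fun I : Ideal R => PrimeSpectrum.zeroLocus (I : Set R) ⊆ Φ) ?_ ?_ ?_
    (fun I hI => D.torVanishes_quotient h I hI) k W hW
  · simp
  · intro I hI J hJ
    rw [PrimeSpectrum.zeroLocus_inf]
    exact Set.union_subset hI hJ
  · exact fun I hI J hIJ => (PrimeSpectrum.zeroLocus_anti_mono hIJ).trans hI

end SyzygyTower

/-! ### The colimit of Ext^i(R/I, -) and its long exact sequence -/

noncomputable section

/-- The ideals `I` with `V(I) ⊆ Φ`, ordered by reverse inclusion. -/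
structure SupportedIdeal {R : Type u} [CommRing R] (Φ : Set (PrimeSpectrum R)) where
  ideal : Ideal R
  zeroLocus_subset : PrimeSpectrum.zeroLocus (ideal : Set R) ⊆ Φ

namespace SupportedIdeal

variable {R : Type u} [CommRing R] {Φ : Set (PrimeSpectrum R)}

instance : Preorder (SupportedIdeal Φ) where
  le I J := J.ideal ≤ I.ideal
  le_refl _ := le_rfl
  le_trans _ _ _ h h' := h'.trans h

theorem le_def {I J : SupportedIdeal Φ} : I ≤ J ↔ J.ideal ≤ I.ideal := Iff.rfl

instance : Nonempty (SupportedIdeal Φ) := ⟨⟨⊤, by simp⟩⟩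

instance : IsDirectedOrder (SupportedIdeal Φ) where
  directed I J := ⟨⟨I.ideal ⊓ J.ideal, by
    rw [PrimeSpectrum.zeroLocus_inf]
    exact Set.union_subset I.zeroLocus_subset J.zeroLocus_subset⟩,
    le_def.2 inf_le_left, le_def.2 inf_le_right⟩

instance : DecidableEq (SupportedIdeal Φ) := Classical.decEq _

/-- The cyclic module `R ⧸ I`. -/
abbrev quotient (I : SupportedIdeal Φ) : ModuleCat.{u} R := ModuleCat.of R (R ⧸ I.ideal)

/-- The projection `R ⧸ J ⟶ R ⧸ I` for `J ⊆ I`. -/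
def quotientMap {I J : SupportedIdeal Φ} (h : I ≤ J) : J.quotient ⟶ I.quotient :=
  ModuleCat.ofHom (Submodule.factor h)

theorem quotientMap_self (I : SupportedIdeal Φ) : quotientMap (le_refl I) = 𝟙 _ := by
  ext
  simp [quotientMap]

theorem quotientMap_comp {I J K : SupportedIdeal Φ} (h : I ≤ J) (h' : J ≤ K) :
    quotientMap h' ≫ quotientMap h = quotientMap (h.trans h') := by
  ext
  simp [quotientMap]

end SupportedIdeal

section

variable {R : Type u} [CommRing R] (Φ : Set (PrimeSpectrum R))

/-- The transition maps `Ext^i(R ⧸ I, M) → Ext^i(R ⧸ J, M)` for `J ⊆ I`. -/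
def extTransition (i : ℕ) (M : ModuleCat.{u} R) (I J : SupportedIdeal Φ) (h : I ≤ J) :
    Ext I.quotient M i →ₗ[R] Ext J.quotient M i :=
  Ext.precompOfLinear (Ext.mk₀ (SupportedIdeal.quotientMap h)) R M (zero_add i)

variable {Φ} in
theorem extTransition_apply {i : ℕ} {M : ModuleCat.{u} R} {I J : SupportedIdeal Φ} (h : I ≤ J)
    (x : Ext I.quotient M i) : extTransition Φ i M I J h x =
      (Ext.mk₀ (SupportedIdeal.quotientMap h)).comp x (zero_add i) := rfl

instance (i : ℕ) (M : ModuleCat.{u} R) :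
    DirectedSystem (fun I : SupportedIdeal Φ => Ext I.quotient M i)
      (fun I J h => extTransition Φ i M I J h) where
  map_self I x := by
    rw [extTransition_apply, SupportedIdeal.quotientMap_self, Ext.mk₀_id_comp]
  map_map I J K h h' x := by
    simp only [extTransition_apply]
    rw [Ext.mk₀_comp_mk₀_assoc, SupportedIdeal.quotientMap_comp]

/-- The filtered colimit of `Ext^i(R ⧸ I, M)` over the ideals `I` with `V(I) ⊆ Φ`. -/
def ExtColim (i : ℕ) (M : Type u) [AddCommGroup M] [Module R M] : Type u :=
  Module.DirectLimit (fun I : SupportedIdeal Φ => Ext I.quotient (ModuleCat.of R M) i)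
    (extTransition Φ i (ModuleCat.of R M))

namespace ExtColim

instance (i : ℕ) (M : Type u) [AddCommGroup M] [Module R M] : AddCommGroup (ExtColim Φ i M) :=
  inferInstanceAs (AddCommGroup (Module.DirectLimit _ _))

instance (i : ℕ) (M : Type u) [AddCommGroup M] [Module R M] : Module R (ExtColim Φ i M) :=
  inferInstanceAs (Module R (Module.DirectLimit _ _))

variable {A B C A' B' C' : Type u} [AddCommGroup A] [AddCommGroup B] [AddCommGroup C]
  [AddCommGroup A'] [AddCommGroup B'] [AddCommGroup C'] [Module R A] [Module R B] [Module R C]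
  [Module R A'] [Module R B'] [Module R C']

variable {Φ} in
/-- The class of an element of `Ext^i(R ⧸ I, M)`. -/
def mk {i : ℕ} (I : SupportedIdeal Φ) :
    Ext I.quotient (ModuleCat.of R A) i →ₗ[R] ExtColim Φ i A :=
  Module.DirectLimit.of R (SupportedIdeal Φ)
    (fun I : SupportedIdeal Φ => Ext I.quotient (ModuleCat.of R A) i)
    (extTransition Φ i (ModuleCat.of R A)) I

variable {Φ}

theorem exists_mk {i : ℕ} (x : ExtColim Φ i A) : ∃ I e, mk I e = x :=
  Module.DirectLimit.exists_of x

theorem mk_transition {i : ℕ} {I J : SupportedIdeal Φ} (h : I ≤ J)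
    (e : Ext I.quotient (ModuleCat.of R A) i) :
    mk J ((Ext.mk₀ (SupportedIdeal.quotientMap h)).comp e (zero_add i)) = mk I e :=
  Module.DirectLimit.of_f (f := extTransition Φ i (ModuleCat.of R A)) (hij := h)

theorem exists_of_mk_eq_zero {i : ℕ} {I : SupportedIdeal Φ}
    {e : Ext I.quotient (ModuleCat.of R A) i} (h : mk I e = 0) :
    ∃ (J : SupportedIdeal Φ) (hIJ : I ≤ J),
      (Ext.mk₀ (SupportedIdeal.quotientMap hIJ)).comp e (zero_add i) = 0 :=
  Module.DirectLimit.of.zero_exact (f := extTransition Φ i (ModuleCat.of R A)) h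

/-- The map induced by composition with an element of `Ext^d(A, B)`. -/
def postcomp {d i j : ℕ} (β : Ext (ModuleCat.of R A) (ModuleCat.of R B) d) (h : i + d = j) :
    ExtColim Φ i A →ₗ[R] ExtColim Φ j B :=
  Module.DirectLimit.map (fun I => Ext.postcompOfLinear β R I.quotient h) (by
    intro I J hIJ
    ext x
    exact Ext.comp_assoc (Ext.mk₀ (SupportedIdeal.quotientMap hIJ)) x β (zero_add i) h (by omega))

theorem postcomp_mk {d i j : ℕ} (β : Ext (ModuleCat.of R A) (ModuleCat.of R B) d) (h : i + d = j)
    (I : SupportedIdeal Φ) (e : Ext I.quotient (ModuleCat.of R A) i) :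
    postcomp β h (mk I e) = mk I (e.comp β h) :=
  Module.DirectLimit.map_apply_of (f := extTransition Φ i (ModuleCat.of R A))
    (f' := extTransition Φ j (ModuleCat.of R B)) _ _ _

theorem postcomp_postcomp {d d' d'' i j k : ℕ} (β : Ext (ModuleCat.of R A) (ModuleCat.of R B) d)
    (γ : Ext (ModuleCat.of R B) (ModuleCat.of R C) d') (h : i + d = j) (h' : j + d' = k)
    (h'' : d + d' = d'') (x : ExtColim Φ i A) :
    postcomp γ h' (postcomp β h x) = postcomp (β.comp γ h'') (by omega : i + d'' = k) x := by
  obtain ⟨I, e, rfl⟩ := exists_mk x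
  rw [postcomp_mk, postcomp_mk, postcomp_mk, Ext.comp_assoc]
  omega

theorem postcomp_zero {d i j : ℕ} (h : i + d = j) (x : ExtColim Φ i A) :
    postcomp (0 : Ext (ModuleCat.of R A) (ModuleCat.of R B) d) h x = 0 := by
  obtain ⟨I, e, rfl⟩ := exists_mk x
  rw [postcomp_mk, Ext.comp_zero, map_zero]

variable (Φ) in
/-- Functoriality of `ExtColim`. -/
def map (i : ℕ) (f : A →ₗ[R] B) : ExtColim Φ i A →ₗ[R] ExtColim Φ i B :=
  postcomp (Ext.mk₀ (ModuleCat.ofHom f)) (add_zero i)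

theorem map_map (i : ℕ) (f : A →ₗ[R] B) (g : B →ₗ[R] C) (x : ExtColim Φ i A) :
    map Φ i g (map Φ i f x) = map Φ i (g ∘ₗ f) x := by
  rw [map, map, postcomp_postcomp _ _ _ _ (zero_add 0), Ext.mk₀_comp_mk₀]
  rfl

theorem map_id (i : ℕ) (x : ExtColim Φ i A) : map Φ i LinearMap.id x = x := by
  obtain ⟨I, e, rfl⟩ := exists_mk x
  rw [map, postcomp_mk, ModuleCat.ofHom_id, Ext.comp_mk₀_id]

theorem map_add (i : ℕ) (f g : A →ₗ[R] B) (x : ExtColim Φ i A) :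
    map Φ i (f + g) x = map Φ i f x + map Φ i g x := by
  obtain ⟨I, e, rfl⟩ := exists_mk x
  simp only [map, postcomp_mk, ModuleCat.ofHom_add, Ext.mk₀_add, Ext.comp_add, _root_.map_add]

theorem map_smul (i : ℕ) (r : R) (f : A →ₗ[R] B) (x : ExtColim Φ i A) :
    map Φ i (r • f) x = r • map Φ i f x := by
  obtain ⟨I, e, rfl⟩ := exists_mk x
  have : ModuleCat.ofHom (r • f) = r • ModuleCat.ofHom f := rfl
  simp only [map, postcomp_mk, this, Ext.mk₀_smul, Ext.comp_smul, _root_.map_smul]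

theorem map_zero (i : ℕ) (x : ExtColim Φ i A) : map Φ i (0 : A →ₗ[R] B) x = 0 := by
  have := map_smul i (0 : R) (0 : A →ₗ[R] B) x
  rwa [zero_smul, zero_smul] at this

theorem map_bijective (i : ℕ) (e : A ≃ₗ[R] B) : Function.Bijective (map Φ i e.toLinearMap) := by
  refine Function.bijective_iff_has_inverse.2 ⟨map Φ i e.symm.toLinearMap, fun x => ?_, fun x => ?_⟩
  · rw [map_map, LinearEquiv.symm_comp, map_id]
  · rw [map_map, LinearEquiv.comp_symm, map_id]

section LongExactSequence

variable {f : A →ₗ[R] B} {g : B →ₗ[R] C} {f' : A' →ₗ[R] B'} {g' : B' →ₗ[R] C'}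

/-- The short complex of a pair of composable linear maps. -/
abbrev shortComplex (hfg : Function.Exact f g) : ShortComplex (ModuleCat.{u} R) :=
  ShortComplex.mk (ModuleCat.ofHom f) (ModuleCat.ofHom g) (by
    ext x
    exact hfg.apply_apply_eq_zero x)

theorem shortComplex_shortExact (hf : Function.Injective f) (hfg : Function.Exact f g)
    (hg : Function.Surjective g) : (shortComplex hfg).ShortExact :=
  ModuleCat.shortComplex_shortExact _ hfg hf hg

variable (hf : Function.Injective f) (hfg : Function.Exact f g) (hg : Function.Surjective g)

/-- The connecting homomorphism. -/
def δ (i : ℕ) : ExtColim Φ i C →ₗ[R] ExtColim Φ (i + 1) A :=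
  postcomp (shortComplex_shortExact hf hfg hg).extClass rfl

include hf hfg hg in
theorem exact_mid (i : ℕ) : Function.Exact (map Φ i f) (map Φ i g) := by
  intro x
  constructor
  · intro hx
    obtain ⟨I, e, rfl⟩ := exists_mk x
    rw [map, postcomp_mk] at hx
    -- Vanishing in the filtered colimit already occurs at some stage J, where exactness of the
    -- ordinary Ext sequence applies.
    obtain ⟨J, h, hJ⟩ := exists_of_mk_eq_zero hx
    rw [← Ext.comp_assoc_of_third_deg_zero] at hJ
    obtain ⟨e', he'⟩ := Ext.covariant_sequence_exact₂ _ (shortComplex_shortExact hf hfg hg) _ hJ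
    refine ⟨mk J e', ?_⟩
    rw [← mk_transition h, ← he']
    exact postcomp_mk _ _ _ _
  · rintro ⟨y, rfl⟩
    rw [map_map, hfg.linearMap_comp_eq_zero, map_zero]

theorem exact_right (i : ℕ) : Function.Exact (map Φ i g) (δ (Φ := Φ) hf hfg hg i) := by
  intro x
  constructor
  · intro hx
    obtain ⟨I, e, rfl⟩ := exists_mk x
    rw [δ, postcomp_mk] at hx
    obtain ⟨J, h, hJ⟩ := exists_of_mk_eq_zero hx
    rw [← Ext.comp_assoc (a₁₂ := i) _ _ _ (by omega) (by omega) (by omega)] at hJ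
    obtain ⟨e', he'⟩ := Ext.covariant_sequence_exact₃ _ (shortComplex_shortExact hf hfg hg) _ rfl hJ
    refine ⟨mk J e', ?_⟩
    rw [← mk_transition h, ← he']
    exact postcomp_mk _ _ _ _
  · rintro ⟨y, rfl⟩
    rw [map, δ, postcomp_postcomp _ _ _ _ (zero_add 1)]
    erw [(shortComplex_shortExact hf hfg hg).comp_extClass]
    exact postcomp_zero _ _

theorem exact_left (i : ℕ) : Function.Exact (δ (Φ := Φ) hf hfg hg i) (map Φ (i + 1) f) := by
  intro x
  constructor
  · intro hx
    obtain ⟨I, e, rfl⟩ := exists_mk x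
    rw [map, postcomp_mk] at hx
    obtain ⟨J, h, hJ⟩ := exists_of_mk_eq_zero hx
    rw [← Ext.comp_assoc_of_third_deg_zero] at hJ
    obtain ⟨e', he'⟩ := Ext.covariant_sequence_exact₁ _ (shortComplex_shortExact hf hfg hg) _ hJ rfl
    refine ⟨mk J e', ?_⟩
    rw [← mk_transition h, ← he']
    exact postcomp_mk _ _ _ _
  · rintro ⟨y, rfl⟩
    rw [map, δ, postcomp_postcomp _ _ _ _ (add_zero 1)]
    erw [(shortComplex_shortExact hf hfg hg).extClass_comp]
    exact postcomp_zero _ _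

theorem δ_naturality (hf' : Function.Injective f') (hfg' : Function.Exact f' g')
    (hg' : Function.Surjective g') (a : A →ₗ[R] A') (b : B →ₗ[R] B') (c : C →ₗ[R] C')
    (hab : b ∘ₗ f = f' ∘ₗ a) (hbc : c ∘ₗ g = g' ∘ₗ b) (i : ℕ) (x : ExtColim Φ i C) :
    map Φ (i + 1) a (δ hf hfg hg i x) = δ hf' hfg' hg' i (map Φ i c x) := by
  let φ : shortComplex hfg ⟶ shortComplex hfg' :=
    { τ₁ := ModuleCat.ofHom a
      τ₂ := ModuleCat.ofHom b
      τ₃ := ModuleCat.ofHom c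
      comm₁₂ := by
        rw [← ModuleCat.ofHom_comp, ← ModuleCat.ofHom_comp, hab]
      comm₂₃ := by
        rw [← ModuleCat.ofHom_comp, ← ModuleCat.ofHom_comp, hbc] }
  rw [map, map, δ, δ, postcomp_postcomp _ _ _ _ (add_zero 1),
    postcomp_postcomp _ _ _ _ (zero_add 1)]
  refine congrArg (fun β => postcomp (d := 1) (j := i + 1) β rfl x) ?_
  exact ShortComplex.ShortExact.extClass_naturality _ _ φ

end LongExactSequence

end ExtColim

end

end

/-! ### Φ-torsion and injective modules over a noetherian ring -/

section Torsion

variable {R : Type u} [CommRing R] {Φ : Set (PrimeSpectrum R)} {A : Type u} [AddCommGroup A]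
  [Module R A]

theorem mem_torsionSubmodule_iff {x : A} : x ∈ torsionSubmodule Φ A ↔
    PrimeSpectrum.zeroLocus (Ideal.torsionOf R A x : Set R) ⊆ Φ := by
  have : Module.support R (Submodule.span R {x}) =
      PrimeSpectrum.zeroLocus (Ideal.torsionOf R A x : Set R) := by
    ext p
    rw [mem_support_span_singleton]
    rfl
  rw [← this]
  rfl

theorem mem_torsionSubmodule_iff_exists {x : A} : x ∈ torsionSubmodule Φ A ↔
    ∃ I : SupportedIdeal Φ, ∀ r ∈ I.ideal, r • x = 0 := by
  rw [mem_torsionSubmodule_iff]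
  exact ⟨fun h => ⟨⟨_, h⟩, fun r hr => hr⟩, fun ⟨I, hI⟩ =>
    (PrimeSpectrum.zeroLocus_anti_mono hI).trans I.zeroLocus_subset⟩

theorem isPhiTorsion_iff : IsPhiTorsion Φ A ↔
    ∀ x : A, ∃ I : SupportedIdeal Φ, ∀ r ∈ I.ideal, r • x = 0 :=
  forall_congr' fun _ => mem_torsionSubmodule_iff.symm.trans mem_torsionSubmodule_iff_exists

theorem IsPhiTorsion.of_surjective {B : Type u} [AddCommGroup B] [Module R B]
    (hA : IsPhiTorsion Φ A) {f : A →ₗ[R] B} (hf : Function.Surjective f) : IsPhiTorsion Φ B := by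
  rw [isPhiTorsion_iff] at hA ⊢
  intro x
  obtain ⟨x, rfl⟩ := hf x
  obtain ⟨I, hI⟩ := hA x
  exact ⟨I, fun r hr => by rw [← map_smul, hI r hr, map_zero]⟩

theorem isPhiTorsion_of_smul_eq_zero {I : Ideal R}
    (hI : PrimeSpectrum.zeroLocus (I : Set R) ⊆ Φ) (h : ∀ r ∈ I, ∀ x : A, r • x = 0) :
    IsPhiTorsion Φ A :=
  isPhiTorsion_iff.2 fun x => ⟨⟨I, hI⟩, fun r hr => h r hr x⟩

theorem isPhiTorsion_torsionSubmodule : IsPhiTorsion Φ (torsionSubmodule Φ A) := by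
  rw [isPhiTorsion_iff]
  rintro ⟨x, hx⟩
  obtain ⟨I, hI⟩ := mem_torsionSubmodule_iff_exists.1 hx
  exact ⟨I, fun r hr => Subtype.ext (hI r hr)⟩

variable (R) in
theorem exists_injective_embedding (A : Type u) [AddCommGroup A] [Module R A] :
    ∃ (E : ModuleCat.{u} R) (f : A →ₗ[R] E), Module.Injective R E ∧ Function.Injective f := by
  refine ⟨Injective.under (ModuleCat.of R A), (Injective.ι (ModuleCat.of R A)).hom, ?_,
    (ModuleCat.mono_iff_injective _).1 inferInstance⟩
  exact (Module.injective_iff_injective_object R _).2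
    (inferInstance : Injective (Injective.under (ModuleCat.of R A)))

variable [IsNoetherianRing R]

/-- Baer's criterion: I is finitely generated, so a map from I meets only the finitely many
coordinates in T, and each coordinate extends separately. -/
instance Module.Injective.finsupp {S : Type u} [Module.Injective R A] :
    Module.Injective R (S →₀ A) := by
  classical
  refine Module.Baer.injective fun I g => ?_
  obtain ⟨t, ht⟩ := (Module.Finite.fg_top : (⊤ : Submodule R I).FG)
  have hA := Module.Baer.of_injective (R := R) (Q := A) ‹_›
  choose g' hg' using fun s => hA I (Finsupp.lapply s ∘ₗ g)
  let T : Finset S := t.biUnion fun x => (g x).support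
  have hT : ∀ x, (g x).support ⊆ T := by
    intro x
    have hx : x ∈ Submodule.span R (t : Set I) := ht ▸ Submodule.mem_top
    induction hx using Submodule.span_induction with
    | mem x h => exact Finset.subset_biUnion_of_mem (fun x => (g x).support) h
    | zero => simp
    | add x y _ _ ihx ihy =>
      rw [map_add]
      exact Finsupp.support_add.trans (Finset.union_subset ihx ihy)
    | smul a x _ ih =>
      rw [map_smul]
      exact Finsupp.support_smul.trans ih
  refine ⟨LinearMap.toSpanSingleton R _ (∑ s ∈ T, Finsupp.single s (g' s 1)), fun x hx => ?_⟩
  ext s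
  rw [LinearMap.toSpanSingleton_apply, Finsupp.smul_apply, Finsupp.finsetSum_apply]
  simp only [Finsupp.single_apply, Finset.sum_ite_eq']
  split_ifs with hs
  · rw [← map_smul, smul_eq_mul, mul_one, hg' s x hx]
    rfl
  · rw [smul_zero]
    exact (Finsupp.notMem_support_iff.1 fun h => hs (hT _ h)).symm

/-- Artin–Rees. The image of g : I → Γ_Φ(A) is killed by one supported J, so g kills J^{k+1} ∩ I ⊆
JI and factors through a submodule of R/J^{k+1}. An extension R/J^{k+1} → A has Φ-torsion image
since V(J^{k+1}) = V(J). -/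
instance Module.Injective.torsionSubmodule [Module.Injective R A] :
    Module.Injective R (torsionSubmodule Φ A) := by
  classical
  refine Module.Baer.injective fun I g => ?_
  obtain ⟨t, ht⟩ := (Module.Finite.fg_top : (⊤ : Submodule R I).FG)
  choose K hK using fun x : I => isPhiTorsion_iff.1 isPhiTorsion_torsionSubmodule (g x)
  obtain ⟨J, hJ⟩ := Finset.exists_le (t.image K)
  have hJg : ∀ r ∈ J.ideal, ∀ x : I, r • g x = 0 := by
    intro r hr x
    have hx : x ∈ Submodule.span R (t : Set I) := ht ▸ Submodule.mem_top
    induction hx using Submodule.span_induction with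
    | mem x h => exact hK x r (hJ _ (Finset.mem_image_of_mem K h) hr)
    | zero => rw [map_zero, smul_zero]
    | add x y _ _ ihx ihy => rw [map_add, smul_add, ihx, ihy, add_zero]
    | smul a x _ ih => rw [map_smul, smul_comm, ih, smul_zero]
  obtain ⟨k, hk⟩ := Ideal.exists_pow_inf_eq_pow_smul J.ideal (I : Submodule R R)
  -- The exponent k + 1 leaves exactly one factor J outside J^k ∩ I.
  have hk := hk (k + 1) (Nat.le_succ k)
  rw [Nat.add_sub_cancel_left, pow_one] at hk
  let q : I →ₗ[R] R ⧸ J.ideal ^ (k + 1) := (J.ideal ^ (k + 1)).mkQ ∘ₗ I.subtype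
  have hq : LinearMap.ker q ≤ LinearMap.ker g := by
    rintro ⟨x, hx⟩ hxq
    have hx' : x ∈ J.ideal ^ (k + 1) := (Submodule.Quotient.mk_eq_zero _).1 hxq
    have hx'' : x ∈ J.ideal • I := by
      refine Submodule.smul_mono le_rfl inf_le_right (hk.le ⟨?_, hx⟩)
      rwa [smul_eq_mul, Ideal.mul_top]
    rw [LinearMap.mem_ker]
    have key : ∀ x ∈ J.ideal • I, ∀ hx : x ∈ I, g ⟨x, hx⟩ = 0 := by
      intro x hx'
      induction hx' using Submodule.smul_induction_on' with
      | smul r hr y hy =>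
        intro hx
        have : (⟨r • y, hx⟩ : I) = r • ⟨y, hy⟩ := rfl
        rw [this, map_smul, hJg r hr]
      | add x hx' y hy' ihx ihy =>
        intro hx
        have hxI := Submodule.smul_le_right hx'
        have hyI := Submodule.smul_le_right hy'
        have : (⟨x + y, hx⟩ : I) = ⟨x, hxI⟩ + ⟨y, hyI⟩ := rfl
        rw [this, map_add, ihx, ihy, add_zero]
    exact key x hx'' hx
  obtain ⟨h, hh⟩ := Module.Injective.out (R := R) (Q := A)
    ((LinearMap.ker q).liftQ q le_rfl)
    (LinearMap.ker_eq_bot.1 (Submodule.ker_liftQ_eq_bot _ _ _ le_rfl))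
    ((LinearMap.ker q).liftQ ((_root_.torsionSubmodule Φ A).subtype ∘ₗ g)
      (hq.trans (LinearMap.ker_le_ker_comp _ _)))
  have hJk : PrimeSpectrum.zeroLocus ((J.ideal ^ (k + 1) : Ideal R) : Set R) ⊆ Φ := by
    rw [PrimeSpectrum.zeroLocus_pow _ (Nat.succ_ne_zero k)]
    exact J.zeroLocus_subset
  refine ⟨LinearMap.toSpanSingleton R _ ⟨h (Submodule.Quotient.mk 1),
    mem_torsionSubmodule_iff_exists.2 ⟨⟨_, hJk⟩, fun r hr => ?_⟩⟩, fun x hx => Subtype.ext ?_⟩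
  · rw [← map_smul, ← Submodule.Quotient.mk_smul, smul_eq_mul, mul_one,
      (Submodule.Quotient.mk_eq_zero _).2 hr, map_zero]
  · refine Eq.trans ?_ (hh (Submodule.Quotient.mk ⟨x, hx⟩))
    rw [LinearMap.toSpanSingleton_apply, Submodule.coe_smul, ← map_smul,
      ← Submodule.Quotient.mk_smul, smul_eq_mul, mul_one]
    rfl

end Torsion

/-! ### `ExtColim` on torsion modules, injectives and direct sums -/

theorem Finsupp.mapRange_linearMap_exact {R : Type*} [CommRing R] {S A B C : Type*}
    [AddCommGroup A] [AddCommGroup B] [AddCommGroup C] [Module R A] [Module R B] [Module R C]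
    {f : A →ₗ[R] B} {g : B →ₗ[R] C} (hfg : Function.Exact f g) :
    Function.Exact (Finsupp.mapRange.linearMap (α := S) f)
      (Finsupp.mapRange.linearMap (α := S) g) := by
  classical
  intro x
  constructor
  · intro hx
    have h : ∀ s, ∃ a, f a = x s := fun s => (hfg _).1 (DFunLike.congr_fun hx s)
    choose a ha using h
    refine ⟨Finsupp.onFinset x.support (fun s => if s ∈ x.support then a s else 0)
      (fun s hs => by by_contra h; exact hs (if_neg h)), ?_⟩
    ext s
    simp only [Finsupp.mapRange.linearMap_apply, Finsupp.mapRange_apply, Finsupp.onFinset_apply]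
    split_ifs with h
    · exact ha s
    · rw [map_zero, Finsupp.notMem_support_iff.1 h]
  · rintro ⟨y, rfl⟩
    ext s
    exact hfg.apply_apply_eq_zero _

namespace ExtColim

variable {R : Type u} [CommRing R] {Φ : Set (PrimeSpectrum R)}
variable {A B C : Type u} [AddCommGroup A] [AddCommGroup B] [AddCommGroup C] [Module R A]
  [Module R B] [Module R C]

/-- Elements of I act as zero on R/I, hence on Ext^i(R/I, A). -/
theorem isPhiTorsion (i : ℕ) : IsPhiTorsion Φ (ExtColim Φ i A) := by
  rw [isPhiTorsion_iff]
  intro x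
  obtain ⟨I, e, rfl⟩ := exists_mk x
  refine ⟨I, fun r hr => ?_⟩
  have h : r • 𝟙 I.quotient = 0 := by
    ext
    change r • (Submodule.Quotient.mk 1 : R ⧸ I.ideal) = 0
    rw [← Submodule.Quotient.mk_smul, smul_eq_mul, mul_one, Submodule.Quotient.mk_eq_zero]
    exact hr
  rw [← _root_.map_smul, ← Ext.mk₀_id_comp e, ← Ext.smul_comp, ← Ext.mk₀_smul, h, Ext.mk₀_zero,
    Ext.zero_comp, _root_.map_zero]

theorem subsingleton_of_injective [Module.Injective R A] (i : ℕ) :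
    Subsingleton (ExtColim Φ (i + 1) A) := by
  have := Module.injective_object_of_injective_module R A
  refine subsingleton_of_forall_eq 0 fun x => ?_
  obtain ⟨I, e, rfl⟩ := exists_mk x
  rw [Ext.eq_zero_of_injective e, _root_.map_zero]

theorem exists_mk_mk₀ (x : ExtColim Φ 0 A) :
    ∃ (I : SupportedIdeal Φ) (f : (R ⧸ I.ideal) →ₗ[R] A),
      mk I (Ext.mk₀ (ModuleCat.ofHom f)) = x := by
  obtain ⟨I, e, rfl⟩ := exists_mk x
  obtain ⟨f, rfl⟩ := (Ext.mk₀_bijective _ _).2 e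
  exact ⟨I, f.hom, rfl⟩

theorem torsionSubmodule_eq_bot (h : Subsingleton (ExtColim Φ 0 A)) :
    torsionSubmodule Φ A = ⊥ := by
  rw [eq_bot_iff]
  intro x hx
  obtain ⟨I, hI⟩ := mem_torsionSubmodule_iff_exists.1 hx
  let f : (R ⧸ I.ideal) →ₗ[R] A := I.ideal.liftQ (LinearMap.toSpanSingleton R A x) hI
  obtain ⟨J, hIJ, hJ⟩ := exists_of_mk_eq_zero
    (Subsingleton.elim (mk I (Ext.mk₀ (ModuleCat.ofHom f))) 0)
  rw [Ext.mk₀_comp_mk₀, Ext.mk₀_eq_zero_iff] at hJ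
  have := LinearMap.congr_fun (ModuleCat.hom_ext_iff.1 hJ) (Submodule.Quotient.mk 1)
  exact (one_smul R x).symm.trans this

theorem subsingleton_of_isPhiTorsion (hA : IsPhiTorsion Φ A)
    (h : Subsingleton (ExtColim Φ 0 A)) : Subsingleton A := by
  refine subsingleton_of_forall_eq 0 fun x => ?_
  have : x ∈ torsionSubmodule Φ A := mem_torsionSubmodule_iff.2 (hA x)
  rwa [torsionSubmodule_eq_bot h] at this

section

variable {f : A →ₗ[R] B} {g : B →ₗ[R] C} (hf : Function.Injective f) (hfg : Function.Exact f g)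
  (hg : Function.Surjective g)

include hf hfg hg

theorem subsingleton_mid (i : ℕ) (hA : Subsingleton (ExtColim Φ i A))
    (hC : Subsingleton (ExtColim Φ i C)) : Subsingleton (ExtColim Φ i B) := by
  refine subsingleton_of_forall_eq 0 fun x => ?_
  obtain ⟨y, rfl⟩ := (exact_mid hf hfg hg i x).1 (Subsingleton.elim _ _)
  rw [Subsingleton.elim y 0, _root_.map_zero]

theorem subsingleton_left (i : ℕ) (hC : Subsingleton (ExtColim Φ i C))
    (hB : Subsingleton (ExtColim Φ (i + 1) B)) : Subsingleton (ExtColim Φ (i + 1) A) := by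
  refine subsingleton_of_forall_eq 0 fun x => ?_
  obtain ⟨y, rfl⟩ := (exact_left hf hfg hg i x).1 (Subsingleton.elim _ _)
  rw [Subsingleton.elim y 0, _root_.map_zero]

theorem subsingleton_right (i : ℕ) (hB : Subsingleton (ExtColim Φ i B))
    (hA : Subsingleton (ExtColim Φ (i + 1) A)) : Subsingleton (ExtColim Φ i C) := by
  refine subsingleton_of_forall_eq 0 fun x => ?_
  obtain ⟨y, rfl⟩ := (exact_right hf hfg hg i x).1 (Subsingleton.elim _ _)
  rw [Subsingleton.elim y 0, _root_.map_zero]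

/-- If `B` is injective and `Γ_Φ B → Γ_Φ C` is surjective, then the colimit of the `Ext^1(R ⧸ I, A)`
vanishes. -/
theorem subsingleton_one [Module.Injective R B]
    (h : ∀ c ∈ torsionSubmodule Φ C, ∃ b ∈ torsionSubmodule Φ B, g b = c) :
    Subsingleton (ExtColim Φ 1 A) := by
  refine subsingleton_of_forall_eq 0 fun x => ?_
  have := subsingleton_of_injective (Φ := Φ) (A := B) 0
  obtain ⟨y, rfl⟩ := (exact_left hf hfg hg 0 x).1 (Subsingleton.elim _ _)
  refine (exact_right hf hfg hg 0 y).2 ?_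
  obtain ⟨I, φ, rfl⟩ := exists_mk_mk₀ y
  have hφ : φ (Submodule.Quotient.mk 1) ∈ torsionSubmodule Φ C := by
    refine mem_torsionSubmodule_iff_exists.2 ⟨I, fun r hr => ?_⟩
    rw [← _root_.map_smul, ← Submodule.Quotient.mk_smul, smul_eq_mul, mul_one,
      (Submodule.Quotient.mk_eq_zero _).2 hr, _root_.map_zero]
  obtain ⟨b, hb, hbφ⟩ := h _ hφ
  obtain ⟨J, hJ⟩ := mem_torsionSubmodule_iff_exists.1 hb
  -- A lift of φ to B need not be killed by I, only by J; over the common stage K both φ and its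
  -- lift are defined.
  obtain ⟨K, hIK, hJK⟩ := exists_ge_ge I J
  let ψ : (R ⧸ K.ideal) →ₗ[R] B :=
    K.ideal.liftQ (LinearMap.toSpanSingleton R B b) fun r hr => hJ r (hJK hr)
  refine ⟨mk K (Ext.mk₀ (ModuleCat.ofHom ψ)), ?_⟩
  rw [← mk_transition hIK, map, postcomp_mk, Ext.mk₀_comp_mk₀, Ext.mk₀_comp_mk₀]
  congr 2
  ext
  change g ((1 : R) • b) = φ (Submodule.Quotient.mk 1)
  rw [one_smul, hbφ]

end

/-- A torsion module embeds in a torsion injective, namely Γ_Φ of an injective containing it. The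
cokernel is again torsion, so degrees can be shifted. -/
theorem subsingleton_succ_of_isPhiTorsion [IsNoetherianRing R] (i : ℕ) :
    ∀ (A : Type u) [AddCommGroup A] [Module R A], IsPhiTorsion Φ A →
      Subsingleton (ExtColim Φ (i + 1) A) := by
  have key (A : Type u) [AddCommGroup A] [Module R A] (hA : IsPhiTorsion Φ A) :
      ∃ (E : ModuleCat.{u} R) (f : A →ₗ[R] E), Module.Injective R E ∧ Function.Injective f ∧
        IsPhiTorsion Φ E := by
    obtain ⟨E, f, hE, hf⟩ := exists_injective_embedding R A
    refine ⟨ModuleCat.of R (torsionSubmodule Φ E), f.codRestrict _ fun x => ?_,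
      inferInstanceAs (Module.Injective R (torsionSubmodule Φ E)), fun x y hxy => ?_,
      isPhiTorsion_torsionSubmodule⟩
    · exact torsionSubmodule_map_mem Φ f x (mem_torsionSubmodule_iff.2 (hA x))
    · exact hf (Subtype.ext_iff.1 hxy)
  induction i with
  | zero =>
    intro A _ _ hA
    obtain ⟨E, f, hE, hf, hEΦ⟩ := key A hA
    refine subsingleton_one hf (LinearMap.exact_map_mkQ_range f) (Submodule.mkQ_surjective _) ?_
    intro c _
    obtain ⟨b, rfl⟩ := Submodule.mkQ_surjective _ c
    exact ⟨b, mem_torsionSubmodule_iff.2 (hEΦ b), rfl⟩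
  | succ i ih =>
    intro A _ _ hA
    obtain ⟨E, f, hE, hf, hEΦ⟩ := key A hA
    exact subsingleton_left hf (LinearMap.exact_map_mkQ_range f) (Submodule.mkQ_surjective _) _
      (ih _ (hEΦ.of_surjective (Submodule.mkQ_surjective _))) (subsingleton_of_injective _)

/-- Functoriality of `ExtColim`, evaluated at an element. -/
noncomputable def mapAt {i : ℕ} (x : ExtColim Φ i A) : (A →ₗ[R] B) →ₗ[R] ExtColim Φ i B where
  toFun f := map Φ i f x
  map_add' f g := map_add i f g x
  map_smul' r f := map_smul i r f x

/-- In degree 0 a map from the cyclic module R/I meets finitely many coordinates. Higher degrees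
follow by shifting along S →₀ E with E injective, which stays injective since R is noetherian. -/
theorem mem_iSup_range_lsingle [IsNoetherianRing R] {S : Type u} (i : ℕ) :
    ∀ (A : Type u) [AddCommGroup A] [Module R A] (x : ExtColim Φ i (S →₀ A)),
      x ∈ ⨆ s : S, LinearMap.range (map Φ i (Finsupp.lsingle (R := R) (M := A) s)) := by
  induction i with
  | zero =>
    intro A _ _ x
    obtain ⟨I, φ, rfl⟩ := exists_mk_mk₀ x
    set x := mk I (Ext.mk₀ (ModuleCat.ofHom φ)) with hx
    let T := (φ (Submodule.Quotient.mk 1)).support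
    let π : (S →₀ A) →ₗ[R] (S →₀ A) := ∑ s ∈ T, Finsupp.lsingle s ∘ₗ Finsupp.lapply s
    have hπ : π ∘ₗ φ = φ := by
      ext : 2
      change π (φ (Submodule.Quotient.mk 1)) = φ (Submodule.Quotient.mk 1)
      rw [LinearMap.sum_apply]
      exact Finsupp.sum_single _
    have h : map Φ 0 π x = x := by
      rw [hx, map, postcomp_mk, Ext.mk₀_comp_mk₀, ← ModuleCat.ofHom_comp, hπ]
    rw [← h]
    change mapAt x π ∈ _
    rw [map_sum]
    refine Submodule.sum_mem _ fun s _ => Submodule.mem_iSup_of_mem s ?_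
    exact ⟨map Φ 0 (Finsupp.lapply s) x, map_map _ _ _ _⟩
  | succ i ih =>
    intro A _ _ x
    obtain ⟨E, f, hE, hf⟩ := exists_injective_embedding R A
    have hfg := LinearMap.exact_map_mkQ_range f
    have hg := Submodule.mkQ_surjective (LinearMap.range f)
    have hF : Function.Injective (Finsupp.mapRange.linearMap (α := S) f) :=
      Finsupp.mapRange_injective _ (_root_.map_zero f) hf
    have hFG := Finsupp.mapRange_linearMap_exact (S := S) hfg
    have hG : Function.Surjective (Finsupp.mapRange.linearMap (α := S) (LinearMap.range f).mkQ) :=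
      Finsupp.mapRange_surjective _ (_root_.map_zero _) hg
    have := subsingleton_of_injective (Φ := Φ) (A := S →₀ E) i
    obtain ⟨y, rfl⟩ := (exact_left hF hFG hG i x).1 (Subsingleton.elim _ _)
    have hy := ih _ y
    have hle : (⨆ s : S, LinearMap.range (map Φ i (Finsupp.lsingle (R := R)
        (M := E ⧸ LinearMap.range f) s))) ≤
        (⨆ s : S, LinearMap.range (map Φ (i + 1) (Finsupp.lsingle (R := R) (M := A) s))).comap
          (δ hF hFG hG i) := by
      refine iSup_le fun s => ?_
      rintro _ ⟨z, rfl⟩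
      refine Submodule.mem_iSup_of_mem s ⟨δ hf hfg hg i z, ?_⟩
      refine δ_naturality hf hfg hg hF hFG hG _ (Finsupp.lsingle s) _ ?_ ?_ i z
      · ext a
        simp
      · ext a
        simp
    exact hle hy

/-- For `Q` projective, the elements of `ExtColim Φ i (A ⊗ Q)` come from the maps `A → A ⊗ Q`,
`a ↦ a ⊗ q`. -/
theorem mem_iSup_range_mk_flip [IsNoetherianRing R] {Q : Type u} [AddCommGroup Q] [Module R Q]
    [Module.Projective R Q] (i : ℕ) (x : ExtColim Φ i (A ⊗[R] Q)) :
    x ∈ ⨆ q : Q, LinearMap.range (map Φ i ((TensorProduct.mk R A Q).flip q)) := by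
  classical
  obtain ⟨σ, hσ⟩ := Module.projective_lifting_property
    (Finsupp.linearCombination R (id : Q → Q)) LinearMap.id
    (Finsupp.linearCombination_id_surjective R Q)
  let e : (Q →₀ A) →ₗ[R] A ⊗[R] Q := Finsupp.lsum R fun q => (TensorProduct.mk R A Q).flip q
  let e' : A ⊗[R] Q →ₗ[R] (Q →₀ A) :=
    (TensorProduct.finsuppScalarRight R R A Q).toLinearMap ∘ₗ σ.lTensor A
  have he : e ∘ₗ e' = LinearMap.id := by
    have h1 : e ∘ₗ (TensorProduct.finsuppScalarRight R R A Q).toLinearMap =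
        (Finsupp.linearCombination R (id : Q → Q)).lTensor A := by
      ext a q
      simp [e, TensorProduct.finsuppScalarRight_apply_tmul]
    rw [← LinearMap.comp_assoc, h1, ← LinearMap.lTensor_comp, hσ, LinearMap.lTensor_id]
  have hx : map Φ i e (map Φ i e' x) = x := by rw [map_map, he, map_id]
  rw [← hx]
  have hle : (⨆ q : Q, LinearMap.range (map Φ i (Finsupp.lsingle (R := R) (M := A) q))) ≤
      (⨆ q : Q, LinearMap.range (map Φ i ((TensorProduct.mk R A Q).flip q))).comap
        (map Φ i e) := by
    refine iSup_le fun q => ?_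
    rintro _ ⟨z, rfl⟩
    refine Submodule.mem_iSup_of_mem q ⟨z, ?_⟩
    rw [map_map]
    congr 1
    ext a
    simp [e]
  exact hle (mem_iSup_range_lsingle i A _)

theorem subsingleton_tensorProduct [IsNoetherianRing R] {Q : Type u} [AddCommGroup Q] [Module R Q]
    [Module.Projective R Q] (i : ℕ) (hA : Subsingleton (ExtColim Φ i A)) :
    Subsingleton (ExtColim Φ i (A ⊗[R] Q)) := by
  refine subsingleton_of_forall_eq 0 fun x => ?_
  have hx := mem_iSup_range_mk_flip i x
  have h : (⨆ q : Q, LinearMap.range (map Φ i ((TensorProduct.mk R A Q).flip q))) = ⊥ := by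
    rw [iSup_eq_bot]
    intro q
    rw [LinearMap.range_eq_bot]
    refine LinearMap.ext fun y => ?_
    rw [Subsingleton.elim y 0, _root_.map_zero, _root_.map_zero]
  rwa [h] at hx

end ExtColim

/-! ### The two directions of the vanishing criterion -/

namespace ExtColim

variable {R : Type u} [CommRing R] {Φ : Set (PrimeSpectrum R)}
variable {A B C : Type u} [AddCommGroup A] [AddCommGroup B] [AddCommGroup C] [Module R A]
  [Module R B] [Module R C]

variable (Φ A) in
/-- The canonical map from `A ⊗ -` of the value at `R` to the value at `A`. -/
noncomputable def tensorMap (i : ℕ) : A ⊗[R] ExtColim Φ i R →ₗ[R] ExtColim Φ i A :=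
  TensorProduct.lift (LinearMap.mk₂ R (fun a w => map Φ i (LinearMap.toSpanSingleton R A a) w)
    (fun a a' w => by rw [LinearMap.toSpanSingleton_add, map_add])
    (fun r a w => by rw [LinearMap.toSpanSingleton_smul, map_smul])
    (fun a w w' => _root_.map_add _ _ _) (fun r a w => _root_.map_smul _ _ _))

theorem tensorMap_tmul (i : ℕ) (a : A) (w : ExtColim Φ i R) :
    tensorMap Φ A i (a ⊗ₜ w) = map Φ i (LinearMap.toSpanSingleton R A a) w := rfl

theorem tensorMap_naturality (i : ℕ) (f : A →ₗ[R] B) (x : A ⊗[R] ExtColim Φ i R) :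
    map Φ i f (tensorMap Φ A i x) = tensorMap Φ B i (f.rTensor _ x) := by
  induction x with
  | zero => simp only [_root_.map_zero]
  | tmul a w =>
    rw [LinearMap.rTensor_tmul, tensorMap_tmul, tensorMap_tmul, map_map,
      LinearMap.comp_toSpanSingleton]
  | add x y hx hy => simp only [_root_.map_add, hx, hy]

theorem tensorMap_self (i : ℕ) (x : R ⊗[R] ExtColim Φ i R) :
    tensorMap Φ R i x = TensorProduct.lid R _ x := by
  induction x with
  | zero => simp only [_root_.map_zero]
  | tmul a w =>
    have : LinearMap.toSpanSingleton R R a = a • LinearMap.id := by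
      ext
      simp
    rw [tensorMap_tmul, TensorProduct.lid_tmul, this, map_smul, map_id]
  | add x y hx hy => simp only [_root_.map_add, hx, hy]

/-- A is a retract of a free module, and there injectivity is tested on coordinates, where the map
is R ⊗ W ≅ W. -/
theorem tensorMap_injective [Module.Projective R A] (i : ℕ) :
    Function.Injective (tensorMap Φ A i) := by
  classical
  obtain ⟨σ, hσ⟩ := Module.projective_lifting_property
    (Finsupp.linearCombination R (id : A → A)) LinearMap.id
    (Finsupp.linearCombination_id_surjective R A)
  refine (injective_iff_map_eq_zero _).2 fun x hx => ?_
  have h : σ.rTensor _ x = 0 := by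
    apply (TensorProduct.finsuppScalarLeft R _ A).injective
    ext s
    rw [_root_.map_zero, Finsupp.zero_apply, TensorProduct.finsuppScalarLeft_apply,
      ← tensorMap_self, ← tensorMap_naturality, ← tensorMap_naturality, hx, _root_.map_zero,
      _root_.map_zero]
  rw [← LinearMap.rTensor_id_apply _ _ x, ← hσ, LinearMap.rTensor_comp_apply, h, _root_.map_zero]

theorem tensorMap_surjective [IsNoetherianRing R] [Module.Projective R A] (i : ℕ) :
    Function.Surjective (tensorMap Φ A i) := by
  intro x
  have hx := mem_iSup_range_mk_flip i (map Φ i (TensorProduct.lid R A).symm.toLinearMap x)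
  have hle : (⨆ q : A, LinearMap.range (map Φ i ((TensorProduct.mk R R A).flip q))) ≤
      (LinearMap.range (tensorMap Φ A i)).comap
        (map Φ i (TensorProduct.lid R A).toLinearMap) := by
    refine iSup_le fun q => ?_
    rintro _ ⟨z, rfl⟩
    refine ⟨q ⊗ₜ z, ?_⟩
    rw [tensorMap_tmul, map_map]
    congr 1
  obtain ⟨y, hy⟩ := hle hx
  rw [map_map, LinearEquiv.comp_symm, map_id] at hy
  exact ⟨y, hy⟩

variable [IsNoetherianRing R] {n : ℕ}
  (hn : ∀ i, n < i → ∀ (A : Type u) [AddCommGroup A] [Module R A], Subsingleton (ExtColim Φ i A))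

-- Descending induction on i for all syzygies at once, starting above n where both sides vanish.
include hn in
theorem tensorMap_syzygy_bijective (D : SyzygyTower R)
    (hD : ∀ i k, D.TorVanishes (ExtColim Φ i R) k) (m : ℕ) :
    ∀ i, n < i + m → ∀ s, Function.Bijective (tensorMap Φ (D.Z s) i) := by
  induction m with
  | zero =>
    intro i hi s
    have := hn i hi (D.Z s)
    have : Subsingleton (D.Z s ⊗[R] ExtColim Φ i R) := by
      have := hn i hi R
      refine subsingleton_of_forall_eq 0 fun x => ?_
      induction x with
      | zero => rfl
      | tmul z w => rw [Subsingleton.elim w 0, tmul_zero]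
      | add x y hx hy => rw [hx, hy, add_zero]
    exact ⟨Function.injective_of_subsingleton _, fun x => ⟨0, Subsingleton.elim _ _⟩⟩
  | succ m ih =>
    intro i hi
    have ih := ih (i + 1) (by omega)
    have hZP (s : ℕ) : Function.Surjective (map Φ i (D.proj s)) := by
      intro x
      refine (exact_right (D.incl_injective s) (D.exact s) (D.proj_surjective s) i x).1 ?_
      obtain ⟨y, hy⟩ := (ih (s + 1)).2
        (δ (D.incl_injective s) (D.exact s) (D.proj_surjective s) i x)
      -- The connecting map vanishes: its values die in degree i + 1 of P s, whereas Z (s + 1) ⊗ W →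
      -- P s ⊗ W is injective by Tor vanishing, for W the value at R.
      have h1 : y = 0 := by
        have hinj : Function.Injective ((D.incl s).rTensor (ExtColim Φ (i + 1) R)) :=
          hD (i + 1) (s + 1)
        apply hinj
        apply tensorMap_injective (i + 1)
        rw [← tensorMap_naturality, hy, _root_.map_zero, _root_.map_zero]
        exact (exact_left (D.incl_injective s) (D.exact s)
          (D.proj_surjective s) i).apply_apply_eq_zero x
      rw [← hy, h1, _root_.map_zero]
    have hsurj (s : ℕ) : Function.Surjective (tensorMap Φ (D.Z s) i) := by
      intro x
      obtain ⟨y, rfl⟩ := hZP s x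
      obtain ⟨z, rfl⟩ := tensorMap_surjective i y
      exact ⟨_, (tensorMap_naturality i _ z).symm⟩
    refine fun s => ⟨(injective_iff_map_eq_zero _).2 fun x hx => ?_, hsurj s⟩
    obtain ⟨b, rfl⟩ := LinearMap.rTensor_surjective _ (D.proj_surjective s) x
    rw [← tensorMap_naturality] at hx
    obtain ⟨c, hc⟩ :=
      (exact_mid (D.incl_injective s) (D.exact s) (D.proj_surjective s) i _).1 hx
    obtain ⟨d, rfl⟩ := hsurj (s + 1) c
    rw [tensorMap_naturality] at hc
    rw [← tensorMap_injective i hc]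
    exact (rTensor_exact _ (D.exact s) (D.proj_surjective s)).apply_apply_eq_zero d

include hn in
theorem subsingleton_of_torVanishes (D : SyzygyTower R)
    (hD : ∀ i k, D.TorVanishes (ExtColim Φ i R) k) (i : ℕ) :
    Subsingleton (ExtColim Φ i (D.Z 0)) := by
  have : Subsingleton (D.Z 0 ⊗[R] ExtColim Φ i R) := hD i 0
  exact (tensorMap_syzygy_bijective hn D hD (n + 1) i (by omega) 0).2.subsingleton

section

variable (D D' : SyzygyTower R) (hD : ∀ i, Subsingleton (ExtColim Φ i (D.Z 0))) {p : Ideal R}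
  (hp : PrimeSpectrum.zeroLocus (p : Set R) ⊆ Φ) (hpD : ∀ r ∈ p, ∀ x : D'.Z 0, r • x = 0)

omit [IsNoetherianRing R] in
include hpD in
theorem smul_eq_zero_of_lTensor_incl_eq_zero (t : ℕ) (x : D.Z 0 ⊗[R] D'.Z (t + 1))
    (hx : (D'.incl t).lTensor _ x = 0) (r : R) (hr : r ∈ p) : r • x = 0 := by
  refine (D.balance D' r t 0).1 (fun y _ => ?_) x hx
  clear * - hpD hr
  induction y with
  | zero => rw [smul_zero]
  | tmul z w => rw [← tmul_smul, hpD r hr, tmul_zero]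
  | add x y hx hy => rw [smul_add, hx, hy, zero_add]

include hn hD hp hpD

/-- Descending induction on i. The kernel of Z 0 ⊗ Z' (t + 1) → Z 0 ⊗ P' t is a Tor module killed by
p, so it has no higher cohomology and the image inherits vanishing in degree i + 1. The cokernel Z 0
⊗ Z' t then has none in degree i. -/
theorem subsingleton_tensor_syzygy (m : ℕ) :
    ∀ i, n < i + m → ∀ t, Subsingleton (ExtColim Φ i (D.Z 0 ⊗[R] D'.Z t)) := by
  induction m with
  | zero => exact fun i hi t => hn i hi _
  | succ m ih =>
    intro i hi t
    let f := (D'.incl t).lTensor (D.Z 0)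
    have hT : IsPhiTorsion Φ (LinearMap.ker f) := isPhiTorsion_of_smul_eq_zero hp
      fun r hr x => Subtype.ext
        (smul_eq_zero_of_lTensor_incl_eq_zero D D' hpD t x.1 x.2 r hr)
    have hex : Function.Exact (LinearMap.ker f).subtype f.rangeRestrict := by
      intro x
      exact Subtype.ext_iff.trans (LinearMap.exact_subtype_ker_map f x)
    have h1 : Subsingleton (ExtColim Φ (i + 1) (LinearMap.range f)) :=
      subsingleton_right (f := (LinearMap.ker f).subtype) (g := f.rangeRestrict)
        Subtype.val_injective hex f.surjective_rangeRestrict (i + 1)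
        (ih (i + 1) (by omega) (t + 1)) (subsingleton_succ_of_isPhiTorsion (i + 1) _ hT)
    have hex' : Function.Exact (LinearMap.range f).subtype ((D'.proj t).lTensor (D.Z 0)) := by
      intro x
      rw [lTensor_exact (D.Z 0) (D'.exact t) (D'.proj_surjective t) x, ← LinearMap.coe_range,
        ← LinearMap.coe_range, Submodule.range_subtype]
    exact subsingleton_right (f := (LinearMap.range f).subtype)
      (g := (D'.proj t).lTensor (D.Z 0)) Subtype.val_injective hex'
      (LinearMap.lTensor_surjective _ (D'.proj_surjective t)) i
      (subsingleton_tensorProduct i (hD i)) h1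

theorem torVanishes_of_subsingleton (k : ℕ) : D.TorVanishes (D'.Z 0) k := by
  have h (t : ℕ) := subsingleton_tensor_syzygy hn D D' hD hp hpD (n + 1) 0 (by omega) t
  cases k with
  | zero =>
    refine subsingleton_of_isPhiTorsion (isPhiTorsion_of_smul_eq_zero hp fun r hr x => ?_) (h 0)
    induction x with
    | zero => rw [smul_zero]
    | tmul z w => rw [← tmul_smul, hpD r hr, tmul_zero]
    | add x y hx hy => rw [smul_add, hx, hy, add_zero]
  | succ t =>
    refine (injective_iff_map_eq_zero _).2 fun x hx => ?_
    rw [← one_smul R x]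
    refine (D.balance D' 1 t 0).2 (fun y hy => ?_) x hx
    have hy' : y ∈ torsionSubmodule Φ (D.Z 0 ⊗[R] D'.Z (t + 1)) :=
      mem_torsionSubmodule_iff_exists.2 ⟨⟨p, hp⟩,
        smul_eq_zero_of_lTensor_incl_eq_zero D D' hpD t y hy⟩
    rw [torsionSubmodule_eq_bot (h (t + 1)), Submodule.mem_bot] at hy'
    rw [hy', smul_zero]

end

end ExtColim

/-! ### Comparison with derived functors -/

namespace SyzygyTower

variable {R : Type u} [CommRing R] (D : SyzygyTower R)

/-- The differential of the projective resolution given by a tower of syzygies. -/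
def d (s : ℕ) : D.P (s + 1) →ₗ[R] D.P s := D.incl s ∘ₗ D.proj (s + 1)

theorem torVanishes_zero_iff (W : Type u) [AddCommGroup W] [Module R W] :
    D.TorVanishes W 0 ↔ Function.Surjective ((D.d 0).rTensor W) := by
  have h := rTensor_exact W (D.exact 0) (D.proj_surjective 0)
  have h1 := LinearMap.rTensor_surjective W (D.proj_surjective 0)
  have h2 := LinearMap.rTensor_surjective W (D.proj_surjective 1)
  have h3 : (D.d 0).rTensor W = (D.incl 0).rTensor W ∘ₗ (D.proj 1).rTensor W :=
    LinearMap.rTensor_comp _ _ _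
  constructor
  · intro (hD : Subsingleton _)
    rw [h3, LinearMap.coe_comp]
    exact Function.Surjective.comp (fun x => (h x).1 (Subsingleton.elim _ _)) h2
  · intro hs
    refine subsingleton_of_forall_eq (α := D.Z 0 ⊗[R] W) 0 fun x => ?_
    obtain ⟨y, rfl⟩ := h1 x
    obtain ⟨z, rfl⟩ := hs y
    rw [h3]
    exact h.apply_apply_eq_zero _

theorem torVanishes_succ_iff (W : Type u) [AddCommGroup W] [Module R W] (s : ℕ) :
    D.TorVanishes W (s + 1) ↔
      Function.Exact ((D.d (s + 1)).rTensor W) ((D.d s).rTensor W) := by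
  have h := rTensor_exact W (D.exact (s + 1)) (D.proj_surjective (s + 1))
  have h1 := LinearMap.rTensor_surjective W (D.proj_surjective (s + 1))
  have h2 := LinearMap.rTensor_surjective W (D.proj_surjective (s + 2))
  have h3 (s : ℕ) : (D.d s).rTensor W = (D.incl s).rTensor W ∘ₗ (D.proj (s + 1)).rTensor W :=
    LinearMap.rTensor_comp _ _ _
  rw [h3, h3]
  constructor
  · intro (hD : Function.Injective _) x
    rw [LinearMap.comp_apply, (injective_iff_map_eq_zero' _).1 hD, h x, LinearMap.coe_comp,
      h2.range_comp]
  · intro hs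
    refine (injective_iff_map_eq_zero _).2 fun x hx => ?_
    obtain ⟨y, rfl⟩ := h1 x
    obtain ⟨z, rfl⟩ := (hs y).1 hx
    exact h.apply_apply_eq_zero _

section

variable {P : ℕ → ModuleCat.{u} R} {M : ModuleCat.{u} R} (d : ∀ s, P (s + 1) →ₗ[R] P s)
  (π : P 0 →ₗ[R] M)

/-- The syzygies of a resolution. -/
def syzygy : ℕ → ModuleCat.{u} R
  | 0 => M
  | 1 => ModuleCat.of R (LinearMap.ker π)
  | s + 2 => ModuleCat.of R (LinearMap.ker (d s))

/-- The tower of syzygies of a projective resolution. -/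
def ofExact (hP : ∀ s, Module.Projective R (P s)) (hπ : Function.Surjective π)
    (h₀ : Function.Exact (d 0) π) (h : ∀ s, Function.Exact (d (s + 1)) (d s)) :
    SyzygyTower R where
  P := P
  Z := syzygy d π
  incl
    | 0 => (LinearMap.ker π).subtype
    | s + 1 => (LinearMap.ker (d s)).subtype
  proj
    | 0 => π
    | 1 => (d 0).codRestrict (LinearMap.ker π) fun x => h₀.apply_apply_eq_zero x
    | s + 2 => (d (s + 1)).codRestrict (LinearMap.ker (d s)) fun x => (h s).apply_apply_eq_zero x
  incl_injective
    | 0 => Subtype.val_injective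
    | s + 1 => Subtype.val_injective
  exact
    | 0 => LinearMap.exact_subtype_ker_map π
    | 1 => fun x => Subtype.ext_iff.trans (LinearMap.exact_subtype_ker_map (d 0) x)
    | s + 2 => fun x => Subtype.ext_iff.trans (LinearMap.exact_subtype_ker_map (d (s + 1)) x)
  proj_surjective
    | 0 => hπ
    | 1 => fun x => by
      obtain ⟨y, hy⟩ := (h₀ x.1).1 x.2
      exact ⟨y, Subtype.ext hy⟩
    | s + 2 => fun x => by
      obtain ⟨y, hy⟩ := (h s x.1).1 x.2
      exact ⟨y, Subtype.ext hy⟩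
  projective := hP

theorem ofExact_d (hP : ∀ s, Module.Projective R (P s)) (hπ : Function.Surjective π)
    (h₀ : Function.Exact (d 0) π) (h : ∀ s, Function.Exact (d (s + 1)) (d s)) (s : ℕ) :
    (ofExact d π hP hπ h₀ h).d s = d s := by
  cases s <;> rfl

end

end SyzygyTower

section

variable {R : Type u} [CommRing R]

theorem exists_syzygyTower (M : ModuleCat.{u} R) : ∃ D : SyzygyTower R, D.Z 0 = M ∧
    ∀ (W : ModuleCat.{u} R) (k : ℕ),
      IsZero (((Tor' (ModuleCat.{u} R) k).obj M).obj W) ↔ D.TorVanishes W k := by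
  let Q := ProjectiveResolution.of M
  let π : Q.complex.X 0 ⟶ M := Q.π.f 0
  have hπ : Function.Surjective π.hom :=
    (ModuleCat.epi_iff_surjective π).1 (inferInstanceAs (Epi (Q.π.f 0)))
  let D := SyzygyTower.ofExact (P := Q.complex.X) (fun s => (Q.complex.d (s + 1) s).hom) π.hom
    (fun s => (IsProjective.iff_projective (R := R) (Q.complex.X s)).2 (Q.projective s)) hπ
    ((ShortComplex.ShortExact.moduleCat_exact_iff_function_exact _).1 Q.exact₀)
    (fun s => (ShortComplex.ShortExact.moduleCat_exact_iff_function_exact _).1 (Q.exact_succ s))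
  refine ⟨D, rfl, fun W k => ?_⟩
  have hd (s : ℕ) : D.d s = (Q.complex.d (s + 1) s).hom := SyzygyTower.ofExact_d _ _ _ _ _ _ s
  let F := (MonoidalCategory.tensoringRight (ModuleCat.{u} R)).obj W
  let K := (F.mapHomologicalComplex (ComplexShape.down ℕ)).obj Q.complex
  have h1 : IsZero (((Tor' (ModuleCat.{u} R) k).obj M).obj W) ↔ K.ExactAt k := by
    rw [HomologicalComplex.exactAt_iff_isZero_homology]
    exact (Q.isoLeftDerivedObj F k).isZero_iff
  have hK (s : ℕ) : (K.d (s + 1) s).hom = (D.d s).rTensor W := by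
    rw [hd]
    rfl
  rw [h1]
  cases k with
  | zero =>
    rw [D.torVanishes_zero_iff, K.exactAt_iff' 1 0 0 (by simp) (by simp),
      ShortComplex.ShortExact.moduleCat_exact_iff_function_exact]
    -- The differential leaving degree 0 is zero, so exactness there means surjectivity of the
    -- incoming one.
    have h0 : (K.sc' 1 0 0).g = 0 := K.shape 0 0 (by simp)
    rw [h0, ← hK]
    exact ⟨fun h x => (h x).1 rfl, fun h x => ⟨fun _ => h x, fun _ => rfl⟩⟩
  | succ s =>
    rw [D.torVanishes_succ_iff, K.exactAt_iff' (s + 2) (s + 1) s (by simp) (by simp),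
      ShortComplex.ShortExact.moduleCat_exact_iff_function_exact, ← hK, ← hK]
    rfl

variable {Φ : Set (PrimeSpectrum R)} {n : ℕ}

theorem isZero_localCohomologyFunctor
    (hcd : cohomologicalDimension Φ ≤ ((n : ℕ∞) : WithBot ℕ∞)) {i : ℕ} (hi : n < i)
    (M : ModuleCat.{u} R) : IsZero ((localCohomologyFunctor Φ i).obj M) := by
  by_contra h
  have : ((i : ℕ∞) : WithBot ℕ∞) ≤ ((n : ℕ∞) : WithBot ℕ∞) := by
    refine (le_sSup ?_).trans hcd
    exact ⟨i, rfl, M, h⟩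
  rw [WithBot.coe_le_coe, Nat.cast_le] at this
  omega

namespace ExtColim

/-- For an injective resolution, H^{j+1}_Φ(M) = 0 says that Γ_Φ(I^j) → Γ_Φ(ker d^{j+1}) is onto.
This kills degree 1 of the cosyzygy ker d^j, and shifting back gives degree j + 1 of ker d^0 ≅ M. -/
theorem subsingleton_of_isZero_localCohomologyFunctor (M : ModuleCat.{u} R) (j : ℕ)
    (h : IsZero ((localCohomologyFunctor Φ (j + 1)).obj M)) :
    Subsingleton (ExtColim Φ (j + 1) M) := by
  let I := InjectiveResolution.of M
  let d (s : ℕ) : I.cocomplex.X s →ₗ[R] I.cocomplex.X (s + 1) := (I.cocomplex.d s (s + 1)).hom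
  have hI (s : ℕ) : Module.Injective R (I.cocomplex.X s) :=
    (Module.injective_iff_injective_object R _).2 (I.injective s)
  have hd (s : ℕ) : Function.Exact (d s) (d (s + 1)) :=
    (ShortComplex.ShortExact.moduleCat_exact_iff_function_exact _).1 (I.exact_succ s)
  let ι : M ⟶ I.cocomplex.X 0 := I.ι.f 0
  have hι : Function.Injective ι.hom :=
    (ModuleCat.mono_iff_injective ι).1 (inferInstanceAs (Mono (I.ι.f 0)))
  have hιd : Function.Exact ι.hom (d 0) :=
    (ShortComplex.ShortExact.moduleCat_exact_iff_function_exact _).1 I.exact₀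
  let g (s : ℕ) : I.cocomplex.X s →ₗ[R] LinearMap.ker (d (s + 1)) :=
    (d s).codRestrict _ fun x => (hd s).apply_apply_eq_zero x
  have hg (s : ℕ) : Function.Surjective (g s) := fun x => by
    obtain ⟨y, hy⟩ := (hd s x.1).1 x.2
    exact ⟨y, Subtype.ext hy⟩
  have hfg (s : ℕ) : Function.Exact (LinearMap.ker (d s)).subtype (g s) := fun x =>
    Subtype.ext_iff.trans (LinearMap.exact_subtype_ker_map (d s) x)
  have hlast : Subsingleton (ExtColim Φ 1 (LinearMap.ker (d j))) := by
    refine subsingleton_one (f := (LinearMap.ker (d j)).subtype) Subtype.val_injective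
      (hfg j) (hg j) fun c hc => ?_
    let K := ((torsionFunctor Φ).mapHomologicalComplex (ComplexShape.up ℕ)).obj I.cocomplex
    have hK : K.ExactAt (j + 1) := by
      rw [HomologicalComplex.exactAt_iff_isZero_homology]
      exact (I.isoRightDerivedObj (torsionFunctor Φ) (j + 1)).isZero_iff.1 h
    rw [K.exactAt_iff' j (j + 1) (j + 2) (by simp) (by simp),
      ShortComplex.ShortExact.moduleCat_exact_iff_function_exact] at hK
    obtain ⟨b, hb⟩ := (hK ⟨c.1, torsionSubmodule_map_mem Φ (Submodule.subtype _) c hc⟩).1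
      (Subtype.ext c.2)
    have hb' : d j b.1 = c.1 := congrArg Subtype.val hb
    exact ⟨b.1, b.2, Subtype.ext hb'⟩
  have hshift (m : ℕ) : ∀ s, s + m = j →
      Subsingleton (ExtColim Φ (m + 1) (LinearMap.ker (d s))) := by
    induction m with
    | zero =>
      rintro s rfl
      exact hlast
    | succ m ih =>
      intro s hs
      exact subsingleton_left (f := (LinearMap.ker (d s)).subtype) Subtype.val_injective
        (hfg s) (hg s) _ (ih (s + 1) (by omega)) (subsingleton_of_injective _)
  let e : M ≃ₗ[R] LinearMap.ker (d 0) :=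
    LinearEquiv.ofBijective (ι.hom.codRestrict _ fun x => hιd.apply_apply_eq_zero x)
      ⟨fun x y hxy => hι (Subtype.ext_iff.1 hxy), fun x => by
        obtain ⟨y, hy⟩ := (hιd x.1).1 x.2
        exact ⟨y, Subtype.ext hy⟩⟩
  have := hshift j 0 (zero_add j)
  exact (map_bijective (j + 1) e).1.subsingleton

theorem subsingleton_of_cohomologicalDimension_le
    (hcd : cohomologicalDimension Φ ≤ ((n : ℕ∞) : WithBot ℕ∞)) (i : ℕ) (hi : n < i) (A : Type u)
    [AddCommGroup A] [Module R A] : Subsingleton (ExtColim Φ i A) := by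
  obtain ⟨j, rfl⟩ : ∃ j, i = j + 1 := ⟨i - 1, by omega⟩
  exact subsingleton_of_isZero_localCohomologyFunctor (ModuleCat.of R A) j
    (isZero_localCohomologyFunctor hcd hi _)

theorem subsingleton_zero_of_torsionSubmodule_eq_bot {A : Type u} [AddCommGroup A] [Module R A]
    (h : torsionSubmodule Φ A = ⊥) : Subsingleton (ExtColim Φ 0 A) := by
  refine subsingleton_of_forall_eq 0 fun x => ?_
  obtain ⟨I, φ, rfl⟩ := exists_mk_mk₀ x
  have hφ : φ (Submodule.Quotient.mk 1) ∈ torsionSubmodule Φ A := by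
    refine mem_torsionSubmodule_iff_exists.2 ⟨I, fun r hr => ?_⟩
    rw [← _root_.map_smul, ← Submodule.Quotient.mk_smul, smul_eq_mul, mul_one,
      (Submodule.Quotient.mk_eq_zero _).2 hr, _root_.map_zero]
  rw [h, Submodule.mem_bot] at hφ
  have : φ = 0 := by
    ext
    exact hφ
  rw [this, ModuleCat.ofHom_zero, Ext.mk₀_zero, _root_.map_zero]

theorem subsingleton_zero_of_injective {A B : Type u} [AddCommGroup A] [Module R A]
    [AddCommGroup B] [Module R B] {f : A →ₗ[R] B} (hf : Function.Injective f)
    (h : Subsingleton (ExtColim Φ 0 B)) : Subsingleton (ExtColim Φ 0 A) := by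
  refine subsingleton_zero_of_torsionSubmodule_eq_bot (eq_bot_iff.2 fun x hx => ?_)
  have := torsionSubmodule_map_mem Φ f x hx
  rw [torsionSubmodule_eq_bot h, Submodule.mem_bot] at this
  exact hf (this.trans (_root_.map_zero f).symm)

end ExtColim

theorem smallSupportPreimage_compl_iff [IsNoetherianRing R] (hΦ : StableUnderSpecialization Φ)
    (hcd : cohomologicalDimension Φ ≤ ((n : ℕ∞) : WithBot ℕ∞)) (M : ModuleCat.{u} R) :
    smallSupportPreimage Φᶜ M ↔ ∀ i, Subsingleton (ExtColim Φ i M) := by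
  have hn := ExtColim.subsingleton_of_cohomologicalDimension_le hcd
  obtain ⟨D, rfl, hD⟩ := exists_syzygyTower M
  have h1 : smallSupportPreimage Φᶜ (D.Z 0) ↔
      ∀ p ∈ Φ, ∀ k, D.TorVanishes p.asIdeal.ResidueField k := by
    constructor
    · intro h p hp k
      rw [← hD (ModuleCat.of R p.asIdeal.ResidueField) k]
      by_contra hk
      exact h ⟨k, hk⟩ hp
    · rintro h p ⟨k, hk⟩ hp
      exact hk ((hD _ k).2 (h p hp k))
  rw [h1]
  constructor
  · exact fun h i => ExtColim.subsingleton_of_torVanishes hn D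
      (fun i k => D.torVanishes_of_isPhiTorsion h (ExtColim.isPhiTorsion i) k) i
  · intro h p hp k
    -- Specialization-closure makes every module killed by p a Φ-torsion module.
    have hpΦ : PrimeSpectrum.zeroLocus (p.asIdeal : Set R) ⊆ Φ := fun q hq =>
      hΦ ((PrimeSpectrum.le_iff_specializes p q).1 hq) hp
    have key (N : ModuleCat.{u} R) (hN : ∀ r ∈ p.asIdeal, ∀ x : N, r • x = 0) :
        D.TorVanishes N k := by
      obtain ⟨D', rfl, -⟩ := exists_syzygyTower N
      exact ExtColim.torVanishes_of_subsingleton hn D D' h hpΦ hN k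
    refine key (ModuleCat.of R p.asIdeal.ResidueField)
      fun r hr (x : p.asIdeal.ResidueField) => ?_
    rw [Algebra.smul_def, Ideal.algebraMap_residueField_eq_zero.2 hr, zero_mul]

/-! ### Dimension shifting along 0 → M → X^0 → ⋯ → X^n → N → 0 -/

namespace IsExactWithZeroEnds

variable {S : ComposableArrows (ModuleCat.{u} R) (n + 2)} (hS : IsExactWithZeroEnds S)

/-- The image of the `j`-th map of an exact sequence. -/
abbrev image (S : ComposableArrows (ModuleCat.{u} R) (n + 2)) (j : ℕ) (hj : j ≤ n + 1) :
    Submodule R (S.obj' (j + 1)) :=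
  LinearMap.range (S.map' j (j + 1)).hom

include hS

theorem exact_subtype_rangeRestrict (j : ℕ) (hj : j ≤ n) :
    Function.Exact (image S j (by omega)).subtype
      (S.map' (j + 1) (j + 2)).hom.rangeRestrict := by
  have h := (ShortComplex.ShortExact.moduleCat_exact_iff_function_exact _).1
    (hS.exact.exact' j (j + 1) (j + 2))
  intro x
  refine Subtype.ext_iff.trans ((h x).trans ?_)
  rw [← LinearMap.coe_range, ← LinearMap.coe_range, Submodule.range_subtype]

variable (hX : ∀ (i : ℕ) (hi : i ≤ n) (k : ℕ), Subsingleton (ExtColim Φ k (S.obj' (i + 1))))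

include hX

/-- Shifting along 0 → image m → X^m → image (m + 1) → 0, whose middle term has no cohomology; image
0 is M up to isomorphism and image (n + 1) is N. -/
theorem subsingleton_add_image_zero (m : ℕ) : ∀ (hm : m ≤ n + 1) (i : ℕ),
    Subsingleton (ExtColim Φ i (image S m hm)) →
      Subsingleton (ExtColim Φ (i + m) (image S 0 (by omega))) := by
  induction m with
  | zero => exact fun _ _ h => h
  | succ m ih =>
    intro hm i h
    rw [show i + (m + 1) = i + 1 + m by omega]
    exact ih (by omega) (i + 1) (ExtColim.subsingleton_left (f := (image S m _).subtype)
      Subtype.val_injective (hS.exact_subtype_rangeRestrict m (by omega))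
      (LinearMap.surjective_rangeRestrict _) i h (hX m (by omega) _))

theorem subsingleton_image_of_add (m : ℕ) : ∀ (hm : m ≤ n + 1) (i : ℕ),
    Subsingleton (ExtColim Φ (i + m) (image S 0 (by omega))) →
      Subsingleton (ExtColim Φ i (image S m hm)) := by
  induction m with
  | zero => exact fun _ _ h => h
  | succ m ih =>
    intro hm i h
    rw [show i + (m + 1) = i + 1 + m by omega] at h
    exact ExtColim.subsingleton_right (f := (image S m (by omega)).subtype)
      Subtype.val_injective (hS.exact_subtype_rangeRestrict m (by omega))
      (LinearMap.surjective_rangeRestrict _) i (hX m (by omega) _) (ih (by omega) (i + 1) h)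

variable (hn : ∀ i, n < i → ∀ (A : Type u) [AddCommGroup A] [Module R A],
  Subsingleton (ExtColim Φ i A))

include hn

theorem subsingleton_first (i : ℕ) : Subsingleton (ExtColim Φ i (S.obj' 0)) := by
  by_cases hi : n < i
  · exact hn i hi _
  have hinj : Function.Injective (S.map' 0 1).hom := (ModuleCat.mono_iff_injective _).1 hS.mono
  -- For i ≤ n, degree i of M reduces to degree 0 of image i, a submodule of X^i.
  have h := hS.subsingleton_add_image_zero hX i (by omega) 0
    (ExtColim.subsingleton_zero_of_injective (f := (image S i (by omega)).subtype)
      Subtype.val_injective (hX i (by omega) 0))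
  rw [zero_add] at h
  exact (ExtColim.map_bijective i (LinearEquiv.ofInjective _ hinj)).1.subsingleton

theorem subsingleton_last (i : ℕ) : Subsingleton (ExtColim Φ i (S.obj' (n + 2))) := by
  have hsurj : Function.Surjective (S.map' (n + 1) (n + 2)).hom :=
    (ModuleCat.epi_iff_surjective _).1 hS.epi
  have h := hS.subsingleton_image_of_add hX (n + 1) le_rfl i (hn _ (by omega) _)
  exact (ExtColim.map_bijective i
    (LinearEquiv.ofTop _ (LinearMap.range_eq_top.2 hsurj)).symm).1.subsingleton

end IsExactWithZeroEnds

end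

theorem mainTheorem2 {R : Type u} [CommRing R] [IsNoetherianRing R]
    (Φ : Set (PrimeSpectrum R)) (hΦ : StableUnderSpecialization Φ) (n : ℕ)
    (hcd : cohomologicalDimension Φ ≤ ((n : ℕ∞) : WithBot ℕ∞)) :
    IsNWide (smallSupportPreimage Φᶜ) n := by
  have hn := ExtColim.subsingleton_of_cohomologicalDimension_le hcd
  have key := smallSupportPreimage_compl_iff hΦ hcd
  refine ⟨⟨fun {S} hS h₁ h₃ => ?_⟩, fun S hS hX => ?_, fun S hS hX => ?_⟩
  · rw [key] at h₁ h₃ ⊢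
    exact fun i => ExtColim.subsingleton_mid hS.moduleCat_injective_f
      ((ShortComplex.ShortExact.moduleCat_exact_iff_function_exact S).1 hS.exact)
      hS.moduleCat_surjective_g i (h₁ i) (h₃ i)
  · exact (key _).2 (hS.subsingleton_first (fun i hi => (key _).1 (hX i hi)) hn)
  · exact (key _).2 (hS.subsingleton_last (fun i hi => (key _).1 (hX i hi)) hn)
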